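/- Let $\Bbbk$ be an algebraically closed field (of any characteristic), let $S$ be a $\Bbbk$-scheme that is smooth of relative dimension $2$ (for example a smooth projective surface over $\Bbbk$), and let $E$ be a locally free sheaf of rank $2$ on $S$. Let $\pi\colon \mathbb P(E)\to S$ be the projective bundle parametrizing invertible quotients of $E$, with tautological quotient $\pi^*E\to\mathcal O_{\mathbb P(E)}(1)$. Assume that $E$ is very ample, i.e. that the line bundle $\mathcal O_{\mathbb P(E)}(1)$ is very ample over $\Bbbk$: there are an integer $n\ge 0$ and an immersion $\varphi\colon\mathbb P(E)\to\mathbb P^n_{\Bbbk}$ over $\Bbbk$ with $\varphi^*\mathcal O(1)\cong\mathcal O_{\mathbb P(E)}(1)$. Then $\det E=\bigwedge^2E$ is $2$-jet ample: for all distinct closed points $x_1,\dots,x_r\in S$ and all positive integers $k_1,\dots,k_r$ with $k_1+\dots+k_r=3$, the natural map $$H^0(S,\det E)\longrightarrow\bigoplus_{i=1}^r (\det E)_{x_i}/\mathfrak m_{x_i}^{k_i}(\det E)_{x_i}$$ is surjective. -/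

import Mathlib

open CategoryTheory AlgebraicGeometry TopologicalSpace Opposite

universe u

attribute [local instance] MvPolynomial.gradedAlgebra

noncomputable section

/-! ### Exterior powers along semilinear maps -/

namespace exteriorPower

variable {R R' R'' : Type u} [CommRing R] [CommRing R'] [CommRing R''] {M N K : Type u}
  [AddCommGroup M] [Module R M] [AddCommGroup N] [Module R' N] [AddCommGroup K] [Module R'' K]

/-- The additive map `⋀ⁿ M → ⋀ⁿ N`, `m₁ ∧ ⋯ ∧ mₙ ↦ f m₁ ∧ ⋯ ∧ f mₙ`, induced by a map `f` that is
semilinear with respect to a homomorphism `φ` of commutative rings. It is itself semilinear. -/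
def mapSemilinear (φ : R →+* R') (f : M →ₛₗ[φ] N) (n : ℕ) : (⋀[R]^n M) →ₛₗ[φ] (⋀[R']^n N) :=
  letI : Module R (⋀[R']^n N) := Module.compHom _ φ
  let g : M [⋀^Fin n]→ₗ[R] (⋀[R']^n N) :=
    { toFun := fun m ↦ ιMulti R' n (fun i ↦ f (m i))
      map_update_add' := fun {inst} m i x y ↦ by
        have h : ∀ z : M, (fun j ↦ f (Function.update m i z j)) =
            Function.update (fun j ↦ f (m j)) i (f z) := fun z ↦ by
          ext j; by_cases hj : j = i
          · subst hj; simp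
          · simp [hj]
        rw [h, h, h, map_add, AlternatingMap.map_update_add]
      map_update_smul' := fun {inst} m i r x ↦ by
        have h : ∀ z : M, (fun j ↦ f (Function.update m i z j)) =
            Function.update (fun j ↦ f (m j)) i (f z) := fun z ↦ by
          ext j; by_cases hj : j = i
          · subst hj; simp
          · simp [hj]
        rw [h, h, f.map_smulₛₗ, AlternatingMap.map_update_smul]
        rfl
      map_eq_zero_of_eq' := fun m i j hm hij ↦
        (ιMulti R' n).map_eq_zero_of_eq _ (by simp [hm]) hij }
  { toFun := alternatingMapLinearEquiv g
    map_add' := map_add _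
    map_smul' := fun r x ↦ (alternatingMapLinearEquiv g).map_smul r x }

lemma mapSemilinear_ιMulti (φ : R →+* R') (f : M →ₛₗ[φ] N) (n : ℕ) (m : Fin n → M) :
    mapSemilinear φ f n (ιMulti R n m) = ιMulti R' n (fun i ↦ f (m i)) := by
  let : Module R (⋀[R']^n N) := Module.compHom _ φ
  exact alternatingMapLinearEquiv_apply_ιMulti _ _

lemma induction_ιMulti {n : ℕ} {p : (⋀[R]^n M) → Prop} (h : ∀ m, p (ιMulti R n m)) (h0 : p 0)
    (hadd : ∀ x y, p x → p y → p (x + y)) (hsmul : ∀ (r : R) x, p x → p (r • x))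
    (x : ⋀[R]^n M) : p x := by
  have hx : x ∈ Submodule.span R (Set.range (ιMulti R n (M := M))) := by
    rw [ιMulti_span]; trivial
  induction hx using Submodule.span_induction with
  | mem y hy => obtain ⟨m, rfl⟩ := hy; exact h m
  | zero => exact h0
  | add y z _ _ hy hz => exact hadd y z hy hz
  | smul r y _ hy => exact hsmul r y hy

lemma mapSemilinear_id {M : Type u} [AddCommGroup M] [Module R M] (φ : R →+* R)
    (hφ : ∀ r, φ r = r) (f : M →ₛₗ[φ] M) (hf : ∀ m, f m = m) (n : ℕ) (x : ⋀[R]^n M) :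
    mapSemilinear φ f n x = x := by
  induction x using induction_ιMulti with
  | h m => rw [mapSemilinear_ιMulti]; simp only [hf]
  | h0 => exact map_zero _
  | hadd x y hx hy => rw [map_add, hx, hy]
  | hsmul r x hx => rw [LinearMap.map_smulₛₗ, hx, hφ]

lemma mapSemilinear_comp (φ : R →+* R') (ψ : R' →+* R'') (χ : R →+* R'')
    (hχ : ∀ r, χ r = ψ (φ r)) (f : M →ₛₗ[φ] N) (g : N →ₛₗ[ψ] K) (h : M →ₛₗ[χ] K)
    (hh : ∀ m, h m = g (f m)) (n : ℕ) (x : ⋀[R]^n M) :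
    mapSemilinear χ h n x = mapSemilinear ψ g n (mapSemilinear φ f n x) := by
  induction x using induction_ιMulti with
  | h m => simp only [mapSemilinear_ιMulti, hh]
  | h0 => simp only [map_zero]
  | hadd x y hx hy => simp only [map_add, hx, hy]
  | hsmul r x hx => simp only [LinearMap.map_smulₛₗ, hx, hχ]

end exteriorPower

namespace AlgebraicGeometry.Scheme.Modules

variable {X : Scheme.{u}}

/-- The restriction map `Γ(M, V) → Γ(M, U)` for `U ⊆ V`, as a semilinear map. -/
def resₛₗ (M : X.Modules) {U V : X.Opens} (i : U ⟶ V) :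
    Γ(M, V) →ₛₗ[(X.presheaf.map i.op).hom] Γ(M, U) where
  toFun s := M.presheaf.map i.op s
  map_add' := map_add _
  map_smul' r s := M.map_smul i r s

/-- The presheaf `U ↦ ⋀ⁿ Γ(M, U)` (exterior power over `Γ(X, U)`). -/
def exteriorPowerAb (M : X.Modules) (n : ℕ) : X.Opensᵒᵖ ⥤ Ab.{u} where
  obj U := AddCommGrpCat.of (⋀[Γ(X, U.unop)]^n Γ(M, U.unop))
  map i := AddCommGrpCat.ofHom
    (exteriorPower.mapSemilinear (X.presheaf.map i.unop.op).hom (M.resₛₗ i.unop) n).toAddMonoidHom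
  map_id U := by
    refine AddCommGrpCat.hom_ext (AddMonoidHom.ext fun x ↦ ?_)
    exact exteriorPower.mapSemilinear_id (X.presheaf.map (𝟙 U.unop).op).hom
      (fun r ↦ by simp) (M.resₛₗ (𝟙 U.unop)) (fun m ↦ by simp [resₛₗ]) n x
  map_comp i j := by
    refine AddCommGrpCat.hom_ext (AddMonoidHom.ext fun x ↦ ?_)
    exact exteriorPower.mapSemilinear_comp (X.presheaf.map i.unop.op).hom
      (X.presheaf.map j.unop.op).hom (X.presheaf.map (i ≫ j).unop.op).hom
      (fun r ↦ by simp) (M.resₛₗ i.unop) (M.resₛₗ j.unop) (M.resₛₗ (i ≫ j).unop)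
      (fun m ↦ by simp [resₛₗ]) n x

/-- The presheaf of modules `U ↦ ⋀ⁿ Γ(M, U)`. -/
def exteriorPowerPresheaf (M : X.Modules) (n : ℕ) : X.PresheafOfModules :=
  letI (U : X.Opensᵒᵖ) : Module (X.ringCatSheaf.obj.obj U) ((M.exteriorPowerAb n).obj U) :=
    inferInstanceAs (Module Γ(X, U.unop) (⋀[Γ(X, U.unop)]^n Γ(M, U.unop)))
  PresheafOfModules.ofPresheaf (R := X.ringCatSheaf.obj) (M.exteriorPowerAb n)
    (fun _ _ i r m ↦
      (exteriorPower.mapSemilinear (X.presheaf.map i.unop.op).hom (M.resₛₗ i.unop) n).map_smulₛₗ r m)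

/-- The exterior power `⋀ⁿ M` of a sheaf of modules `M` on a scheme: the sheaf associated with the
presheaf `U ↦ ⋀ⁿ Γ(M, U)`. -/
def exteriorPower (M : X.Modules) (n : ℕ) : X.Modules :=
  (PresheafOfModules.sheafification (𝟙 X.ringCatSheaf.obj)).obj (M.exteriorPowerPresheaf n)

/-- The stalk `M_x` is a module over the local ring `𝒪_{X, x}`. -/
instance stalkModule (M : X.Modules) (x : X) :
    Module (X.presheaf.stalk x) (M.presheaf.stalk x) :=
  letI N : _root_.PresheafOfModules.{u} (X.presheaf ⋙ forget₂ CommRingCat RingCat) := M.val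
  letI : Module (X.presheaf.stalk x) (TopCat.Presheaf.stalk (C := Ab.{u}) (X := X.carrier) N.presheaf x) := inferInstance
  this

/-- `M` is locally free of rank `n`: every point has an open neighbourhood `U` with sections
`e₁, …, eₙ ∈ Γ(M, U)` whose restrictions form a basis of `Γ(M, V)` over `Γ(X, V)` for every open
`V ⊆ U`, i.e. which define an isomorphism `𝒪_Uⁿ ≅ M|_U`. -/
def IsLocallyFreeOfRank (M : X.Modules) (n : ℕ) : Prop :=
  ∀ x : X, ∃ U : X.Opens, x ∈ U ∧ ∃ e : Fin n → Γ(M, U), ∀ (V : X.Opens) (h : V ≤ U),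
    ∃ b : Module.Basis (Fin n) Γ(X, V) Γ(M, V), ∀ j, b j = M.presheaf.map (homOfLE h).op (e j)

/-! ### Jet ampleness -/

/-- The jet map `H⁰(X, L) → L_x / 𝔪_xᵐ L_x`. -/
def jetMap (L : X.Modules) (x : X) (m : ℕ) (s : Γ(L, (⊤ : X.Opens))) :
    L.presheaf.stalk x ⧸ ((IsLocalRing.maximalIdeal (X.presheaf.stalk x)) ^ m •
      (⊤ : Submodule (X.presheaf.stalk x) (L.presheaf.stalk x))) :=
  Submodule.Quotient.mk (L.presheaf.germ ⊤ x (Opens.mem_top x) s)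

/-- `L` is `k`-jet ample: for all distinct closed points `x₁, …, x_r` and positive integers
`k₁, …, k_r` with `∑ kᵢ = k + 1`, the map `H⁰(X, L) → ⨁ᵢ L_{xᵢ} / 𝔪_{xᵢ}^{kᵢ} L_{xᵢ}` is
surjective. -/
def IsJetAmple (L : X.Modules) (k : ℕ) : Prop :=
  ∀ (r : ℕ) (x : Fin r → X) (m : Fin r → ℕ), Function.Injective x →
    (∀ i, IsClosed ({x i} : Set X)) → (∀ i, 0 < m i) → ∑ i, m i = k + 1 →
      Function.Surjective (fun (s : Γ(L, (⊤ : X.Opens))) (i : Fin r) ↦ L.jetMap (x i) (m i) s)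

end AlgebraicGeometry.Scheme.Modules

/-! ### Projective space and very ample line bundles -/

namespace AlgebraicGeometry

variable (k : Type u) [Field k] (n : ℕ)

/-- Projective space `ℙⁿ = Proj k[x₀, …, xₙ]`. -/
def PSpace : Scheme.{u} := Proj (MvPolynomial.homogeneousSubmodule (Fin (n + 1)) k)

namespace PSpace

/-- The structure morphism `ℙⁿ ⟶ Spec k`. -/
def toSpec : PSpace k n ⟶ Spec (.of k) :=
  Proj.toSpecZero (MvPolynomial.homogeneousSubmodule (Fin (n + 1)) k) ≫
    Spec.map (CommRingCat.ofHom
      (algebraMap k (MvPolynomial.homogeneousSubmodule (Fin (n + 1)) k 0)))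

variable {n}

/-- The standard open set `D₊(xⱼ)`. -/
def chart (j : Fin (n + 1)) : (PSpace k n).Opens :=
  Proj.basicOpen (MvPolynomial.homogeneousSubmodule (Fin (n + 1)) k) (MvPolynomial.X j)

/-- The regular function `xᵢ / xⱼ` on `D₊(xⱼ)`. -/
def ratio (i j : Fin (n + 1)) : Γ(PSpace k n, chart k j) :=
  Proj.awayToSection (MvPolynomial.homogeneousSubmodule (Fin (n + 1)) k) (MvPolynomial.X j)
    (HomogeneousLocalization.Away.mk (MvPolynomial.homogeneousSubmodule (Fin (n + 1)) k)
      ((MvPolynomial.mem_homogeneousSubmodule 1 _).2 (MvPolynomial.isHomogeneous_X k j)) 1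
      (MvPolynomial.X i) (by
        rw [one_smul]
        exact (MvPolynomial.mem_homogeneousSubmodule 1 _).2 (MvPolynomial.isHomogeneous_X k i)))

end PSpace

variable {k n} {X : Scheme.{u}}

namespace Scheme.Modules

/-- The restriction of a global section of `L` to the open set `U`. -/
def globalRes (L : X.Modules) (U : X.Opens) (s : Γ(L, (⊤ : X.Opens))) : Γ(L, U) :=
  L.presheaf.map (homOfLE le_top).op s

/-- `φ : X ⟶ ℙⁿ` is the morphism given by the sections `s₀, …, sₙ` of `L`, in other words there is
an isomorphism `φ^* 𝒪(1) ≅ L` with `φ^* xᵢ ↦ sᵢ` for all `i`: on `φ⁻¹ D₊(xⱼ)` the section `sⱼ` is a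
basis of `L`, and `sᵢ = φ^*(xᵢ / xⱼ) sⱼ`. -/
structure IsMorphismOfSections (L : X.Modules) (s : Fin (n + 1) → Γ(L, (⊤ : X.Opens)))
    (φ : X ⟶ PSpace k n) : Prop where
  bijective_smul : ∀ (j : Fin (n + 1)) (V : X.Opens), V ≤ φ ⁻¹ᵁ PSpace.chart k j →
    Function.Bijective (fun a : Γ(X, V) ↦ a • L.globalRes V (s j))
  eq_smul : ∀ i j : Fin (n + 1),
    L.globalRes (φ ⁻¹ᵁ PSpace.chart k j) (s i) =
      φ.app (PSpace.chart k j) (PSpace.ratio k i j) • L.globalRes (φ ⁻¹ᵁ PSpace.chart k j) (s j)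

/-- An invertible sheaf `L` on a `k`-scheme `f : X ⟶ Spec k` is very ample (over `k`) if some
sections `s₀, …, sₙ ∈ H⁰(X, L)` define an immersion `X ⟶ ℙⁿ` over `k`; equivalently, if there is
an immersion `φ : X ⟶ ℙⁿ` over `k` with `φ^* 𝒪(1) ≅ L`. -/
def IsVeryAmpleLineBundle (f : X ⟶ Spec (.of k)) (L : X.Modules) : Prop :=
  L.IsLocallyFreeOfRank 1 ∧
    ∃ (n : ℕ) (s : Fin (n + 1) → Γ(L, (⊤ : X.Opens))) (φ : X ⟶ PSpace k n),
      L.IsMorphismOfSections s φ ∧ φ ≫ PSpace.toSpec k n = f ∧ IsImmersion φ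

/-! ### Projective bundles and very ample vector bundles -/

variable {S P : Scheme.{u}}

/-- `q : f^* E ⟶ L` is an invertible quotient of the pullback of `E` along `f : T ⟶ S`. -/
structure IsInvertibleQuotient (E : S.Modules) {T : Scheme.{u}} (f : T ⟶ S) (L : T.Modules)
    (q : (pullback f).obj E ⟶ L) : Prop where
  invertible : L.IsLocallyFreeOfRank 1
  epi : Epi q

/-- `π : P ⟶ S` together with `q : π^* E ⟶ L` is the projective bundle `ℙ(E)` with its tautological
quotient `π^* E ⟶ 𝒪(1)` (convention of Grothendieck: `ℙ(E) = Proj Sym E` and `π_* 𝒪(1) = E`): `q` is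
an invertible quotient, and it is universal, i.e. every invertible quotient `r : f^* E ⟶ M` for a
morphism `f : T ⟶ S` is isomorphic to the pullback of `q` along a unique `S`-morphism `g : T ⟶ P`. -/
structure IsProjectiveBundle (E : S.Modules) (π : P ⟶ S) (L : P.Modules)
    (q : (pullback π).obj E ⟶ L) : Prop where
  isInvertibleQuotient : E.IsInvertibleQuotient π L q
  existsUnique : ∀ {T : Scheme.{u}} (f : T ⟶ S) (M : T.Modules) (r : (pullback f).obj E ⟶ M),
    E.IsInvertibleQuotient f M r → ∃! g : T ⟶ P, ∃ (h : g ≫ π = f) (e : (pullback g).obj L ≅ M),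
      (pullback g).map q ≫ e.hom =
        (pullbackComp g π).hom.app E ≫ (pullbackCongr h).hom.app E ≫ r

/-- A vector bundle `E` on a `k`-scheme `f : S ⟶ Spec k` is very ample if the tautological line
bundle `𝒪(1)` on `ℙ(E)` is very ample. -/
def IsVeryAmple (f : S ⟶ Spec (.of k)) (E : S.Modules) : Prop :=
  ∃ (P : Scheme.{u}) (π : P ⟶ S) (L : P.Modules) (q : (pullback π).obj E ⟶ L),
    E.IsProjectiveBundle π L q ∧ L.IsVeryAmpleLineBundle (π ≫ f)

end Scheme.Modules

end AlgebraicGeometry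

end

noncomputable section

namespace AlgebraicGeometry.Scheme.Modules

variable {X Y Z : Scheme.{u}}

/-- The structure sheaf, as a sheaf of modules. -/
abbrev structureModule (X : Scheme.{u}) : X.Modules := SheafOfModules.unit X.ringCatSheaf

/-- The map on sections of a morphism `L ⟶ g_* 𝒪_X`. -/
def ev {g : X ⟶ Y} {L : Y.Modules} (α : L ⟶ (pushforward g).obj (structureModule X))
    (V : Y.Opens) : Γ(L, V) →+ Γ(X, g ⁻¹ᵁ V) :=
  (α.app V).hom

variable {g : X ⟶ Y} {L : Y.Modules} (α : L ⟶ (pushforward g).obj (structureModule X))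

lemma ev_smul (V : Y.Opens) (a : Γ(Y, V)) (s : Γ(L, V)) :
    ev α V (a • s) = g.app V a * ev α V s :=
  α.app_smul a s

lemma ev_res {U V : Y.Opens} (i : U ⟶ V) (s : Γ(L, V)) :
    ev α U (L.presheaf.map i.op s) = X.presheaf.map ((Opens.map g.base).map i).op (ev α V s) :=
  CategoryTheory.congr_fun (α.mapPresheaf.naturality i.op) s

/-- A morphism `L ⟶ N` of sheaves of modules from compatible linear maps on sections. -/
def homOfSections {L N : Y.Modules} (F : ∀ V : Y.Opens, Γ(L, V) →+ Γ(N, V))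
    (hsmul : ∀ V (a : Γ(Y, V)) s, F V (a • s) = a • F V s)
    (hres : ∀ (U V : Y.Opens) (i : U ⟶ V) s,
      F U (L.presheaf.map i.op s) = N.presheaf.map i.op (F V s)) :
    L ⟶ N :=
  (fullyFaithfulToPresheafOfModules (X := Y)).preimage
    (PresheafOfModules.homMk
      { app := fun V ↦ AddCommGrpCat.ofHom (F V.unop)
        naturality := fun U V i ↦ by
          ext s
          exact hres V.unop U.unop i.unop s }
      (fun V a s ↦ hsmul V.unop a s))

instance final_opensMap (f : X ⟶ Y) : (Opens.map f.base).Final where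
  out U := isConnected_of_isTerminal (x := StructuredArrow.mk (Y := (⊤ : Y.Opens)) (homOfLE le_top)) _
    (Limits.IsTerminal.ofUniqueHom
      (fun V ↦ StructuredArrow.homMk (homOfLE le_top) (Subsingleton.elim _ _))
      (fun V m ↦ by ext1; exact Subsingleton.elim _ _))

lemma homEquiv_pullbackComp (f : X ⟶ Y) (g : Y ⟶ Z) {E : Z.Modules} {N : X.Modules}
    (r : (pullback (f ≫ g)).obj E ⟶ N) :
    (pullbackPushforwardAdjunction (f ≫ g)).homEquiv _ _ r =
      (pullbackPushforwardAdjunction g).homEquiv _ _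
        ((pullbackPushforwardAdjunction f).homEquiv _ _ ((pullbackComp f g).hom.app E ≫ r)) ≫
        (pushforwardComp f g).hom.app N := by
  have h := unit_conjugateEquiv ((pullbackPushforwardAdjunction g).comp
    (pullbackPushforwardAdjunction f)) (pullbackPushforwardAdjunction (f ≫ g))
    (pullbackComp f g).inv E
  rw [conjugateEquiv_pullbackComp_inv] at h
  have hr : r = (pullbackComp f g).inv.app E ≫ ((pullbackComp f g).hom.app E ≫ r) := by simp
  conv_lhs => rw [hr]
  rw [Adjunction.homEquiv_unit, Functor.map_comp, ← Category.assoc, ← h]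
  simp only [Category.assoc]
  rw [← NatTrans.naturality]
  simp only [Adjunction.homEquiv_unit, Adjunction.comp_unit_app, Functor.comp_map, Functor.map_comp, Category.assoc]

/-- The map on sections of a morphism `L ⟶ g_* 𝒪_X`, for opens whose preimage is everything. -/
def evTop (V : Y.Opens) (hV : ⊤ ≤ g ⁻¹ᵁ V) : Γ(L, V) →+ Γ(X, ⊤) :=
  (X.presheaf.map (homOfLE hV).op).hom.toAddMonoidHom.comp (ev α V)

lemma evTop_apply (V : Y.Opens) (hV : ⊤ ≤ g ⁻¹ᵁ V) (s : Γ(L, V)) :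
    evTop α V hV s = X.presheaf.map (homOfLE hV).op (ev α V s) := rfl

lemma evTop_smul (V : Y.Opens) (hV : ⊤ ≤ g ⁻¹ᵁ V) (a : Γ(Y, V)) (s : Γ(L, V)) :
    evTop α V hV (a • s) = g.appLE V ⊤ hV a * evTop α V hV s := by
  rw [evTop_apply, ev_smul, map_mul]
  rfl

lemma evTop_res {U V : Y.Opens} (i : U ⟶ V) (hU : ⊤ ≤ g ⁻¹ᵁ U) (hV : ⊤ ≤ g ⁻¹ᵁ V) (s : Γ(L, V)) :
    evTop α U hU (L.presheaf.map i.op s) = evTop α V hV s := by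
  rw [evTop_apply, ev_res, evTop_apply, ← ConcreteCategory.comp_apply, ← Functor.map_comp]
  rfl

/-- `L ⟶ g_* 𝒪_X` is adjoint to an isomorphism `g^* L ≅ 𝒪_X`. -/
def IsTrivialization {g : X ⟶ Y} {L : Y.Modules}
    (α : L ⟶ (pushforward g).obj (structureModule X)) : Prop :=
  IsIso (((pullbackPushforwardAdjunction g).homEquiv _ _).symm α)

/-- Multiplication by a function, as an endomorphism of the structure sheaf. -/
def mulHom (u : Γ(X, ⊤)) : structureModule X ⟶ structureModule X :=
  homOfSections
    (fun V ↦ AddMonoidHom.mulLeft (X.presheaf.map (homOfLE le_top).op u : Γ(X, V)))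
    (fun V (a : Γ(X, V)) (s : Γ(X, V)) ↦ mul_left_comm _ a s)
    (fun U V i (s : Γ(X, V)) ↦ by
      change _ * X.presheaf.map i.op s = X.presheaf.map i.op (_ * s)
      rw [map_mul, ← ConcreteCategory.comp_apply (X.presheaf.map _), ← Functor.map_comp]
      rfl)

lemma mulHom_comp (u v : Γ(X, ⊤)) (h : u * v = 1) : mulHom u ≫ mulHom v = 𝟙 _ := by
  ext U (s : Γ(X, U))
  change X.presheaf.map _ v * (X.presheaf.map _ u * s) = s
  rw [← mul_assoc, ← map_mul, mul_comm v u, h, map_one, one_mul]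

/-- Multiplication by a unit, as an automorphism of the structure sheaf. -/
def mulUnit (u : Γ(X, ⊤)ˣ) : structureModule X ≅ structureModule X where
  hom := mulHom u
  inv := mulHom ↑u⁻¹
  hom_inv_id := mulHom_comp _ _ (by simp)
  inv_hom_id := mulHom_comp _ _ (by simp)

/-- The structure morphism `𝒪_Y ⟶ h_* 𝒪_X`. -/
def unitToPushforward (h : X ⟶ Y) : structureModule Y ⟶ (pushforward h).obj (structureModule X) :=
  SheafOfModules.unitToPushforwardObjUnit h.toRingCatSheafHom

lemma isTrivialization_unitToPushforward (h : X ⟶ Y) : IsTrivialization (unitToPushforward h) := by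
  have : (SheafOfModules.pushforward.{u} h.toRingCatSheafHom).IsRightAdjoint :=
    inferInstanceAs (pushforward h).IsRightAdjoint
  have := final_opensMap h
  exact SheafOfModules.instIsIsoPullbackObjUnitToUnitOfFinal (F := Opens.map h.base) h.toRingCatSheafHom

lemma exists_comp (h : Z ⟶ X) (hα : IsTrivialization α) :
    ∃ β : L ⟶ (pushforward (h ≫ g)).obj (structureModule Z), IsTrivialization β ∧
      ∀ (V : Y.Opens) (hV : ⊤ ≤ g ⁻¹ᵁ V) (hV' : ⊤ ≤ (h ≫ g) ⁻¹ᵁ V) (s : Γ(L, V)),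
        evTop β V hV' s = h.appTop (evTop α V hV s) := by
  let r := ((pullbackPushforwardAdjunction g).homEquiv _ _).symm α
  have : IsIso r := hα
  have : IsIso (((pullbackPushforwardAdjunction h).homEquiv _ _).symm (unitToPushforward h)) :=
    isTrivialization_unitToPushforward h
  let b := (pullbackComp h g).inv.app L ≫ (pullback h).map r ≫
    ((pullbackPushforwardAdjunction h).homEquiv _ _).symm (unitToPushforward h)
  refine ⟨(pullbackPushforwardAdjunction (h ≫ g)).homEquiv _ _ b, ?_, ?_⟩
  · rw [IsTrivialization, Equiv.symm_apply_apply]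
    infer_instance
  · have : (pullbackPushforwardAdjunction (h ≫ g)).homEquiv _ _ b =
      α ≫ (pushforward g).map (unitToPushforward h) ≫ (pushforwardComp h g).hom.app _ := by
      rw [homEquiv_pullbackComp]
      simp only [b, Iso.hom_inv_id_app_assoc]
      rw [Adjunction.homEquiv_naturality_left, Equiv.apply_symm_apply,
        Adjunction.homEquiv_naturality_right]
      simp [r]
    rw [this]
    intro V hV hV' s
    have hnat := CategoryTheory.congr_fun (h.naturality (homOfLE hV).op) (ev α V s)
    simp only [ConcreteCategory.comp_apply] at hnat
    exact hnat.symm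

lemma exists_scale (hα : IsTrivialization α) (u : Γ(X, ⊤)ˣ) :
    ∃ β : L ⟶ (pushforward g).obj (structureModule X), IsTrivialization β ∧
      ∀ (V : Y.Opens) (hV : ⊤ ≤ g ⁻¹ᵁ V) (s : Γ(L, V)),
        evTop β V hV s = u * evTop α V hV s := by
  refine ⟨α ≫ (pushforward g).map (mulUnit u).hom, ?_, ?_⟩
  · have : IsIso (((pullbackPushforwardAdjunction g).homEquiv _ _).symm α) := hα
    rw [IsTrivialization, Adjunction.homEquiv_naturality_right_symm]
    infer_instance
  · intro V hV s
    change X.presheaf.map _ (X.presheaf.map _ (u : Γ(X, ⊤)) * ev α V s) = _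
    rw [map_mul, ← ConcreteCategory.comp_apply, ← Functor.map_comp]
    congr 1
    exact CategoryTheory.congr_fun (X.presheaf.map_id _) _

end AlgebraicGeometry.Scheme.Modules

namespace AlgebraicGeometry.Scheme.Modules

variable {X Y Z : Scheme.{u}}

/-! ### Frames -/

/-- The sections `e₁, …, eₙ` of `E` over `U` form a basis over every open subset of `U`. -/
def IsFrame (E : Y.Modules) {n : ℕ} (U : Y.Opens) (e : Fin n → Γ(E, U)) : Prop :=
  ∀ (V : Y.Opens) (h : V ≤ U), ∃ b : Module.Basis (Fin n) Γ(Y, V) Γ(E, V),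
    ∀ j, b j = E.presheaf.map (homOfLE h).op (e j)

namespace IsFrame

variable {E : Y.Modules} {n : ℕ} {U : Y.Opens} {e : Fin n → Γ(E, U)} (he : E.IsFrame U e)

include he in
lemma mono {U' : Y.Opens} (h : U' ≤ U) : E.IsFrame U' (fun i ↦ E.presheaf.map (homOfLE h).op (e i)) := by
  intro V hV
  obtain ⟨b, hb⟩ := he V (hV.trans h)
  refine ⟨b, fun j ↦ (hb j).trans ?_⟩
  rw [← ConcreteCategory.comp_apply, ← Functor.map_comp]
  rfl

/-- The coordinates of a section with respect to a frame. -/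
def coord {V : Y.Opens} (h : V ≤ U) : Γ(E, V) ≃ₗ[Γ(Y, V)] (Fin n → Γ(Y, V)) :=
  (he V h).choose.equivFun

lemma sum_coord {V : Y.Opens} (h : V ≤ U) (s : Γ(E, V)) :
    ∑ i, he.coord h s i • E.presheaf.map (homOfLE h).op (e i) = s := by
  refine Eq.trans (Finset.sum_congr rfl fun i _ ↦ ?_) ((he V h).choose.sum_equivFun s)
  rw [(he V h).choose_spec]
  rfl

lemma coord_sum {V : Y.Opens} (h : V ≤ U) (a : Fin n → Γ(Y, V)) :
    he.coord h (∑ i, a i • E.presheaf.map (homOfLE h).op (e i)) = a := by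
  refine Eq.trans (congrArg _ ?_) ((he V h).choose.equivFun.apply_symm_apply a)
  rw [Module.Basis.equivFun_symm_apply]
  exact Finset.sum_congr rfl fun i _ ↦ by rw [(he V h).choose_spec]

lemma coord_res {V V' : Y.Opens} (h : V ≤ U) (i : V' ⟶ V) (s : Γ(E, V)) (j : Fin n) :
    he.coord (i.le.trans h) (E.presheaf.map i.op s) j = Y.presheaf.map i.op (he.coord h s j) := by
  conv_lhs => rw [← he.sum_coord h s]
  have : E.presheaf.map i.op (∑ j, he.coord h s j • E.presheaf.map (homOfLE h).op (e j)) =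
      ∑ j, Y.presheaf.map i.op (he.coord h s j) •
        E.presheaf.map (homOfLE (i.le.trans h)).op (e j) := by
    rw [map_sum]
    refine Finset.sum_congr rfl fun j _ ↦ ?_
    rw [map_smul, ← ConcreteCategory.comp_apply, ← Functor.map_comp]
    rfl
  rw [this, coord_sum]

lemma coord_frame {V : Y.Opens} (h : V ≤ U) (j : Fin n) :
    he.coord h (E.presheaf.map (homOfLE h).op (e j)) = Pi.single j 1 := by
  conv_rhs => rw [← he.coord_sum h (Pi.single j 1)]
  congr 1
  simp [Pi.single_apply]

variable (f : X ⟶ Y) (hf : ⊤ ≤ f ⁻¹ᵁ U) (l : Fin n → Γ(X, ⊤))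

/-- The morphism `E ⟶ f_* 𝒪_X` with given values on a frame over an open set containing the image
of `f`. -/
def hom : E ⟶ (pushforward f).obj (structureModule X) :=
  have hV (V : Y.Opens) : f ⁻¹ᵁ V ≤ f ⁻¹ᵁ (V ⊓ U) := le_inf le_rfl (le_top.trans hf)
  homOfSections (fun V ↦
    { toFun := fun s ↦ (∑ i, f.appLE (V ⊓ U) (f ⁻¹ᵁ V) (hV V)
          (he.coord inf_le_right (E.presheaf.map (homOfLE inf_le_left).op s) i) *
          X.presheaf.map (homOfLE le_top).op (l i) : Γ(X, f ⁻¹ᵁ V))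
      map_zero' := by simp only [map_zero, Pi.zero_apply, zero_mul, Finset.sum_const_zero]; rfl
      map_add' := fun s t ↦ by
        simp only [map_add, Pi.add_apply, add_mul, Finset.sum_add_distrib]; rfl })
    (fun V a s ↦ by
      change (∑ i, f.appLE (V ⊓ U) (f ⁻¹ᵁ V) (hV V)
          (he.coord inf_le_right (E.presheaf.map (homOfLE inf_le_left).op (a • s)) i) *
          X.presheaf.map (homOfLE le_top).op (l i) : Γ(X, f ⁻¹ᵁ V)) = f.app V a *
          ∑ i, f.appLE (V ⊓ U) (f ⁻¹ᵁ V) (hV V)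
          (he.coord inf_le_right (E.presheaf.map (homOfLE inf_le_left).op s) i) *
          X.presheaf.map (homOfLE le_top).op (l i)
      rw [Finset.mul_sum]
      refine Finset.sum_congr rfl fun i _ ↦ ?_
      rw [map_smul, LinearEquiv.map_smul, Pi.smul_apply, smul_eq_mul, map_mul, mul_assoc,
        ← ConcreteCategory.comp_apply, Scheme.Hom.map_appLE, Scheme.Hom.appLE,
        ConcreteCategory.comp_apply]
      congr 1
      exact CategoryTheory.congr_fun (X.presheaf.map_id _) _)
    (fun V' V i s ↦ by
      change (∑ j, f.appLE (V' ⊓ U) (f ⁻¹ᵁ V') (hV V')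
          (he.coord inf_le_right (E.presheaf.map (homOfLE inf_le_left).op
            (E.presheaf.map i.op s)) j) *
          X.presheaf.map (homOfLE le_top).op (l j) : Γ(X, f ⁻¹ᵁ V')) =
          X.presheaf.map ((Opens.map f.base).map i).op (∑ i, f.appLE (V ⊓ U) (f ⁻¹ᵁ V) (hV V)
          (he.coord inf_le_right (E.presheaf.map (homOfLE inf_le_left).op s) i) *
          X.presheaf.map (homOfLE le_top).op (l i))
      rw [map_sum]
      refine Finset.sum_congr rfl fun j _ ↦ ?_
      have : E.presheaf.map (homOfLE inf_le_left).op (E.presheaf.map i.op s) =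
        E.presheaf.map (homOfLE (inf_le_inf_right U i.le)).op
          (E.presheaf.map (homOfLE inf_le_left).op s) := by
        simp only [← ConcreteCategory.comp_apply, ← Functor.map_comp]
        rfl
      rw [this, he.coord_res inf_le_right, map_mul]
      simp only [← ConcreteCategory.comp_apply]
      rw [Scheme.Hom.map_appLE, Scheme.Hom.appLE_map, ← Functor.map_comp]
      rfl)

lemma evTop_hom_self (i : Fin n) : evTop (he.hom f hf l) U hf (e i) = l i := by
  have h := he.coord_frame (V := U ⊓ U) inf_le_right i
  change X.presheaf.map (homOfLE hf).op (∑ j, f.appLE (U ⊓ U) (f ⁻¹ᵁ U) _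
    (he.coord inf_le_right (E.presheaf.map (homOfLE inf_le_left).op (e i)) j) *
      X.presheaf.map (homOfLE le_top).op (l j)) = l i
  rw [h, Finset.sum_eq_single i]
  · rw [Pi.single_eq_same, map_one, one_mul, ← ConcreteCategory.comp_apply, ← Functor.map_comp]
    exact CategoryTheory.congr_fun (X.presheaf.map_id _) _
  · intro j _ hj
    rw [Pi.single_eq_of_ne hj, map_zero, zero_mul]
  · simp

include he in
/-- Morphisms to the structure sheaf with equal values on a frame are equal. -/
lemma hom_ext {α β : E ⟶ (pushforward f).obj (structureModule X)} (hf : ⊤ ≤ f ⁻¹ᵁ U)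
    (h : ∀ i, evTop α U hf (e i) = evTop β U hf (e i)) : α = β := by
  have hinj (V : Y.Opens) {a b : Γ(X, f ⁻¹ᵁ V)}
    (hab : X.presheaf.map (homOfLE (inf_le_left : f ⁻¹ᵁ V ⊓ f ⁻¹ᵁ U ≤ f ⁻¹ᵁ V)).op a =
      X.presheaf.map (homOfLE (inf_le_left : f ⁻¹ᵁ V ⊓ f ⁻¹ᵁ U ≤ f ⁻¹ᵁ V)).op b) : a = b := by
    have hle : f ⁻¹ᵁ V ≤ f ⁻¹ᵁ V ⊓ f ⁻¹ᵁ U := le_inf le_rfl (le_top.trans hf)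
    have := congrArg (X.presheaf.map (homOfLE hle).op) hab
    simp only [← ConcreteCategory.comp_apply, ← Functor.map_comp] at this
    exact (CategoryTheory.congr_fun (X.presheaf.map_id _) a).symm.trans
      (this.trans (CategoryTheory.congr_fun (X.presheaf.map_id _) b))
  have hU (i : Fin n) : ev α U (e i) = ev β U (e i) := by
    refine hinj U ?_
    have := congrArg (X.presheaf.map (homOfLE (le_top : f ⁻¹ᵁ U ⊓ f ⁻¹ᵁ U ≤ ⊤)).op) (h i)
    simp only [evTop_apply, ← ConcreteCategory.comp_apply, ← Functor.map_comp] at this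
    exact this
  ext V (s : Γ(E, V))
  change ev α V s = ev β V s
  refine hinj V ?_
  have h1 (γ : E ⟶ (pushforward f).obj (structureModule X)) :=
    ev_res γ (homOfLE (inf_le_left : V ⊓ U ≤ V)) s
  refine (h1 α).symm.trans (Eq.trans ?_ (h1 β))
  rw [← he.sum_coord inf_le_right (E.presheaf.map (homOfLE (inf_le_left : V ⊓ U ≤ V)).op s)]
  simp only [map_sum, ev_smul, ev_res, hU]

include he in
lemma homEquiv_symm_congr {f f' : X ⟶ Y} (h : f = f')
    {α : E ⟶ (pushforward f).obj (structureModule X)}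
    {β : E ⟶ (pushforward f').obj (structureModule X)} (hf : ⊤ ≤ f ⁻¹ᵁ U) (hf' : ⊤ ≤ f' ⁻¹ᵁ U)
    (hαβ : ∀ i, evTop α U hf (e i) = evTop β U hf' (e i)) :
    ((pullbackPushforwardAdjunction f').homEquiv _ _).symm β =
      (pullbackCongr h.symm).hom.app E ≫
        ((pullbackPushforwardAdjunction f).homEquiv _ _).symm α := by
  subst h
  rw [he.hom_ext f hf hαβ]
  simp [pullbackCongr]

/-- A morphism to a direct image of the structure sheaf which takes a unit as value is adjoint to
an epimorphism. -/
lemma epi_of_isUnit {E : Y.Modules} {U : Y.Opens} (f : X ⟶ Y) (hf : ⊤ ≤ f ⁻¹ᵁ U)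
    (α : E ⟶ (pushforward f).obj (structureModule X)) (s : Γ(E, U))
    (hs : IsUnit (evTop α U hf s)) :
    Epi (((pullbackPushforwardAdjunction f).homEquiv _ _).symm α) := by
  constructor
  intro N h h' hh
  have h1 := congrArg ((pullbackPushforwardAdjunction f).homEquiv _ _) hh
  rw [Adjunction.homEquiv_naturality_right, Adjunction.homEquiv_naturality_right,
    Equiv.apply_symm_apply] at h1
  have h2 : h.app (f ⁻¹ᵁ U) (ev α U s) = h'.app (f ⁻¹ᵁ U) (ev α U s) :=
    CategoryTheory.congr_fun (congrArg (fun γ ↦ γ.app U) h1) s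
  obtain ⟨v, hv⟩ := hs.exists_left_inv
  ext W (a : Γ(X, W))
  let b : Γ(X, W) := X.presheaf.map (homOfLE (le_top.trans hf)).op (ev α U s)
  let c : Γ(X, W) := a * X.presheaf.map (homOfLE le_top).op v
  have ha : a = c * b := by
    have := congrArg (X.presheaf.map (homOfLE (le_top : W ≤ ⊤)).op) hv
    rw [map_mul, map_one, evTop_apply, ← ConcreteCategory.comp_apply (X.presheaf.map _),
      ← Functor.map_comp] at this
    exact (mul_one a).symm.trans ((congrArg _ this.symm).trans (mul_assoc _ _ _).symm)
  have key (k : structureModule X ⟶ N) : k.app W a = c • N.presheaf.map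
      (homOfLE (le_top.trans hf)).op (k.app (f ⁻¹ᵁ U) (ev α U s)) :=
    (congrArg (k.app W) ha).trans ((k.app_smul (M := structureModule X) c b).trans
      (congrArg _ (CategoryTheory.congr_fun (k.mapPresheaf.naturality
        (homOfLE (le_top.trans hf)).op) (ev α U s))))
  exact (key h).trans ((congrArg _ (congrArg _ h2)).trans (key h').symm)

lemma isLocallyFreeOfRank_structureModule (X : Scheme.{u}) :
    (structureModule X).IsLocallyFreeOfRank 1 := by
  intro x
  refine ⟨⊤, trivial, fun _ ↦ (1 : Γ(X, ⊤)), fun V h ↦ ⟨Module.Basis.singleton (Fin 1) Γ(X, V),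
    fun j ↦ ?_⟩⟩
  refine (Module.Basis.singleton_apply (Fin 1) Γ(X, V) j).trans ?_
  exact (map_one (X.presheaf.map (homOfLE h).op).hom).symm

end IsFrame

/-! ### Points of projective bundles -/

variable {S P : Scheme.{u}} {E : S.Modules} {π : P ⟶ S} {L : P.Modules}
  {q : (pullback π).obj E ⟶ L}

/-- The adjoint `E ⟶ π_* L` of the tautological quotient. -/
def adj (q : (pullback π).obj E ⟶ L) : E ⟶ (pushforward π).obj L :=
  (pullbackPushforwardAdjunction π).homEquiv _ _ q

/-- The value at `σ ∈ Γ(E, U)` of the invertible quotient of `E` corresponding to a point of a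
projective bundle. -/
def value {T : Scheme.{u}} (q : (pullback π).obj E ⟶ L) {g : T ⟶ P}
    (α : L ⟶ (pushforward g).obj (structureModule T)) (U : S.Opens) (hU : ⊤ ≤ (g ≫ π) ⁻¹ᵁ U)
    (σ : Γ(E, U)) : Γ(T, ⊤) :=
  evTop α (π ⁻¹ᵁ U) hU ((adj q).app U σ)

/-- The quotient of the pullback of `E` corresponding to a point of a projective bundle. -/
def quotientHom {T : Scheme.{u}} (q : (pullback π).obj E ⟶ L) {g : T ⟶ P}
    (α : L ⟶ (pushforward g).obj (structureModule T)) :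
    E ⟶ (pushforward (g ≫ π)).obj (structureModule T) :=
  adj q ≫ (pushforward π).map α ≫ (pushforwardComp g π).hom.app _

lemma evTop_quotientHom {T : Scheme.{u}} (q : (pullback π).obj E ⟶ L) {g : T ⟶ P}
    (α : L ⟶ (pushforward g).obj (structureModule T)) (U : S.Opens) (hU : ⊤ ≤ (g ≫ π) ⁻¹ᵁ U)
    (σ : Γ(E, U)) : evTop (quotientHom q α) U hU σ = value q α U hU σ := rfl

lemma homEquiv_symm_quotientHom {T : Scheme.{u}} (q : (pullback π).obj E ⟶ L) {g : T ⟶ P}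
    (α : L ⟶ (pushforward g).obj (structureModule T)) :
    (pullbackComp g π).hom.app E ≫
      ((pullbackPushforwardAdjunction (g ≫ π)).homEquiv _ _).symm (quotientHom q α) =
      (pullback g).map q ≫ ((pullbackPushforwardAdjunction g).homEquiv _ _).symm α := by
  have h := homEquiv_pullbackComp g π
    (((pullbackPushforwardAdjunction (g ≫ π)).homEquiv _ _).symm (quotientHom q α))
  rw [Equiv.apply_symm_apply] at h
  have h' : adj q ≫ (pushforward π).map α = (pullbackPushforwardAdjunction π).homEquiv _ _ (q ≫ α) :=
    ((pullbackPushforwardAdjunction π).homEquiv_naturality_right q α).symm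
  conv_lhs at h => rw [quotientHom, ← Category.assoc, h']
  rw [cancel_mono, EmbeddingLike.apply_eq_iff_eq, ← Equiv.symm_apply_eq] at h
  rw [← h, Adjunction.homEquiv_naturality_left_symm]

/-- The points of a projective bundle with given values on a frame. -/
lemma IsProjectiveBundle.exists_point (hP : E.IsProjectiveBundle π L q) {n : ℕ} {U : S.Opens}
    {e : Fin n → Γ(E, U)} (he : E.IsFrame U e) {T : Scheme.{u}} (f : T ⟶ S) (hf : ⊤ ≤ f ⁻¹ᵁ U)
    (l : Fin n → Γ(T, ⊤)) (hl : ∃ i, IsUnit (l i)) :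
    ∃ (g : T ⟶ P) (α : L ⟶ (pushforward g).obj (structureModule T)) (h : g ≫ π = f),
      IsTrivialization α ∧ ∀ i, value q α U (h ▸ hf) (e i) = l i := by
  obtain ⟨i, hi⟩ := hl
  let r := ((pullbackPushforwardAdjunction f).homEquiv _ _).symm (he.hom f hf l)
  have hr : E.IsInvertibleQuotient f (structureModule T) r :=
    ⟨IsFrame.isLocallyFreeOfRank_structureModule T,
      IsFrame.epi_of_isUnit f hf _ (e i) (by rwa [he.evTop_hom_self])⟩
  obtain ⟨g, ⟨h, ε, hε⟩, -⟩ := hP.existsUnique f _ r hr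
  subst h
  refine ⟨g, (pullbackPushforwardAdjunction g).homEquiv _ _ ε.hom, rfl, ?_, fun i ↦ ?_⟩
  · rw [IsTrivialization, Equiv.symm_apply_apply]
    infer_instance
  · have h1 := homEquiv_symm_quotientHom q ((pullbackPushforwardAdjunction g).homEquiv _ _ ε.hom)
    rw [Equiv.symm_apply_apply, hε, cancel_epi] at h1
    simp only [pullbackCongr, eqToIso_refl, Iso.refl_hom, NatTrans.id_app, Category.id_comp] at h1
    rw [← evTop_quotientHom, (Equiv.symm_apply_eq _).1 h1, Equiv.apply_symm_apply, he.evTop_hom_self]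

/-- A point of a projective bundle is determined by its values on a frame. -/
lemma IsProjectiveBundle.point_ext (hP : E.IsProjectiveBundle π L q) {n : ℕ} {U : S.Opens}
    {e : Fin n → Γ(E, U)} (he : E.IsFrame U e) {T : Scheme.{u}} {g g' : T ⟶ P}
    {α : L ⟶ (pushforward g).obj (structureModule T)}
    {α' : L ⟶ (pushforward g').obj (structureModule T)}
    (hα : IsTrivialization α) (hα' : IsTrivialization α') (h : g ≫ π = g' ≫ π)
    (hU : ⊤ ≤ (g ≫ π) ⁻¹ᵁ U) (hU' : ⊤ ≤ (g' ≫ π) ⁻¹ᵁ U)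
    (he' : ∀ i, value q α U hU (e i) = value q α' U hU' (e i))
    (hunit : ∃ i, IsUnit (value q α U hU (e i))) :
    ∃ h : g = g', h ▸ α = α' := by
  obtain ⟨i, hi⟩ := hunit
  have hr : E.IsInvertibleQuotient (g ≫ π) (structureModule T)
    (((pullbackPushforwardAdjunction (g ≫ π)).homEquiv _ _).symm (quotientHom q α)) :=
    ⟨IsFrame.isLocallyFreeOfRank_structureModule T,
      IsFrame.epi_of_isUnit _ hU _ (e i) hi⟩
  have hgg : g = g' := by
    refine (hP.existsUnique _ _ _ hr).unique ⟨rfl, @asIso _ _ _ _ _ hα, ?_⟩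
      ⟨h.symm, @asIso _ _ _ _ _ hα', ?_⟩
    · simp only [pullbackCongr, eqToIso_refl, Iso.refl_hom, NatTrans.id_app, Category.id_comp]
      exact (homEquiv_symm_quotientHom q α).symm
    · refine (homEquiv_symm_quotientHom q α').symm.trans ?_
      congr 1
      exact he.homEquiv_symm_congr h hU hU' he'
  subst hgg
  refine ⟨rfl, ?_⟩
  have h1 : quotientHom q α = quotientHom q α' := he.hom_ext _ hU he'
  rw [quotientHom, quotientHom, ← Category.assoc, ← Category.assoc, cancel_mono, adj,
    ← Adjunction.homEquiv_naturality_right, ← Adjunction.homEquiv_naturality_right,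
    EmbeddingLike.apply_eq_iff_eq] at h1
  have := hP.isInvertibleQuotient.epi
  exact (cancel_epi q).1 h1

end AlgebraicGeometry.Scheme.Modules

open Polynomial in
/-- Two polynomials with `p(t) = t q(t⁻¹)` are `a + b t` and `b + a t`. -/
lemma Polynomial.exists_of_toLaurent_eq {R : Type*} [CommRing R] {p q : R[X]}
    (h : toLaurent p = LaurentPolynomial.T 1 * LaurentPolynomial.invert (toLaurent q)) :
    ∃ a b : R, p = C a + C b * X ∧ q = C b + C a * X := by
  have hnat (p : R[X]) (n : ℕ) : (toLaurent p).coeff (n : ℤ) = p.coeff n := by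
    rw [LaurentPolynomial.coeff_toLaurent]
    exact Finsupp.mapDomain_apply Nat.castEmbedding.injective _ _
  have hneg (p : R[X]) (n : ℤ) (hn : n < 0) : (toLaurent p).coeff n = 0 := by
    rw [LaurentPolynomial.coeff_toLaurent]
    refine Finsupp.mapDomain_of_notMem_range _ _ ?_
    rintro ⟨m, rfl⟩
    exact absurd hn (by simp)
  have key (n : ℤ) : (toLaurent p).coeff n = (toLaurent q).coeff (1 - n) := by
    rw [h]
    refine (AddMonoidAlgebra.coeff_single_mul_apply _ _ _ _).trans ?_
    rw [one_mul, LaurentPolynomial.invert_apply, neg_add_rev, neg_neg, add_comm, sub_eq_add_neg]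
  refine ⟨p.coeff 0, p.coeff 1, ?_, ?_⟩
  · ext n
    match n with
    | 0 => simp
    | 1 => simp
    | n + 2 =>
      rw [← hnat, key, hneg _ _ (by push_cast; omega)]
      simp
  · ext n
    match n with
    | 0 => simpa using (hnat q 0).symm.trans ((key 1).symm.trans (hnat p 1))
    | 1 => simpa using (hnat q 1).symm.trans ((key 0).symm.trans (hnat p 0))
    | n + 2 =>
      have := key (1 - (n + 2 : ℕ))
      rw [sub_sub_cancel, hnat, hneg _ _ (by push_cast; omega)] at this
      rw [← this]
      simp

namespace AlgebraicGeometry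

lemma IsAffineOpen.SpecMap_fromSpec_appLE {X : Scheme.{u}} {U : X.Opens} (hU : IsAffineOpen U)
    {R : CommRingCat.{u}} (φ : Γ(X, U) ⟶ R) (h : ⊤ ≤ (Spec.map φ ≫ hU.fromSpec) ⁻¹ᵁ U) :
    (Spec.map φ ≫ hU.fromSpec).appLE U ⊤ h = φ ≫ (Scheme.ΓSpecIso R).inv := by
  rw [Scheme.Hom.comp_appLE, hU.fromSpec_app_self, Scheme.ΓSpecIso_inv_naturality, Category.assoc]
  congr 1

lemma IsAffineOpen.le_SpecMap_fromSpec {X : Scheme.{u}} {U : X.Opens} (hU : IsAffineOpen U)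
    {R : CommRingCat.{u}} (φ : Γ(X, U) ⟶ R) : ⊤ ≤ (Spec.map φ ≫ hU.fromSpec) ⁻¹ᵁ U := by
  simp

/-- A morphism into an affine open set is determined by the map on functions. -/
lemma IsAffineOpen.toSpecΓ_SpecMap_appLE_fromSpec {X T : Scheme.{u}} {U : X.Opens}
    (hU : IsAffineOpen U) (f : T ⟶ X) (hf : ⊤ ≤ f ⁻¹ᵁ U) :
    T.toSpecΓ ≫ Spec.map (f.appLE U ⊤ hf) ≫ hU.fromSpec = f := by
  have : IsIso (⊤ : T.Opens).ι := inferInstanceAs (IsIso T.topIso.hom)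
  rw [← cancel_epi (⊤ : T.Opens).ι, ← Category.assoc, ← Scheme.Opens.toSpecΓ_top,
    Scheme.Opens.toSpecΓ_SpecMap_appLE_assoc, hU.toSpecΓ_fromSpec, Scheme.Hom.resLE_comp_ι]

namespace Scheme.Modules

variable {S P : Scheme.{u}} {E : S.Modules} {π : P ⟶ S} {L : P.Modules}
  {q : (pullback π).obj E ⟶ L}

/-- The pullback of a global section along a point of a projective bundle. -/
def evGlobal {T : Scheme.{u}} {g : T ⟶ P} (α : L ⟶ (pushforward g).obj (structureModule T)) :
    Γ(L, ⊤) →+ Γ(T, ⊤) := evTop α ⊤ le_rfl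

lemma IsProjectiveBundle.exists_polynomial (hP : E.IsProjectiveBundle π L q) {U : S.Opens}
    (hU : IsAffineOpen U) {e : Fin 2 → Γ(E, U)} (he : E.IsFrame U e) (s : Γ(L, ⊤))
    {j j' : Fin 2} (hj : j ≠ j') :
    ∃ p : Polynomial Γ(S, U), ∀ {T : Scheme.{u}} {g : T ⟶ P}
      {α : L ⟶ (pushforward g).obj (structureModule T)}, IsTrivialization α →
      ∀ (hg : ⊤ ≤ (g ≫ π) ⁻¹ᵁ U) (v : Γ(T, ⊤)), value q α U hg (e j) * v = 1 →
      evGlobal α s = value q α U hg (e j) *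
        p.eval₂ ((g ≫ π).appLE U ⊤ hg).hom (value q α U hg (e j') * v) := by
  let R := CommRingCat.of (Polynomial Γ(S, U))
  let f₀ : Spec R ⟶ S := Spec.map (CommRingCat.ofHom Polynomial.C) ≫ hU.fromSpec
  let t : Γ(Spec R, ⊤) := (Scheme.ΓSpecIso R).inv Polynomial.X
  have hf₀ : ⊤ ≤ f₀ ⁻¹ᵁ U := hU.le_SpecMap_fromSpec _
  obtain ⟨g₀, α₀, h₀, hα₀, hv₀⟩ := hP.exists_point he f₀ hf₀ (fun i ↦ if i = j then 1 else t)
    ⟨j, by simp⟩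
  have hg₀ : ⊤ ≤ (g₀ ≫ π) ⁻¹ᵁ U := by rwa [h₀]
  refine ⟨(Scheme.ΓSpecIso R).hom (evGlobal α₀ s), fun {T g α} hα hg v hv ↦ ?_⟩
  let φ := Polynomial.eval₂RingHom ((g ≫ π).appLE U ⊤ hg).hom (value q α U hg (e j') * v)
  let h : T ⟶ Spec R := T.toSpecΓ ≫ Spec.map (CommRingCat.ofHom φ)
  have happ (a : R) : h.appTop ((Scheme.ΓSpecIso R).inv a) = φ a := by
    rw [← ConcreteCategory.comp_apply, Scheme.Hom.comp_appTop, ← Category.assoc,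
      ← Scheme.ΓSpecIso_inv_naturality, Scheme.toSpecΓ_appTop]
    simp
  have hh : h ≫ g₀ ≫ π = g ≫ π := by
    rw [h₀, ← hU.toSpecΓ_SpecMap_appLE_fromSpec (g ≫ π) hg]
    simp only [h, f₀, Category.assoc, ← Spec.map_comp_assoc]
    congr 3
    exact CommRingCat.hom_ext (RingHom.ext fun a ↦ Polynomial.eval₂_C _ _)
  obtain ⟨β, hβ, hβv⟩ := exists_comp α₀ h hα₀
  obtain ⟨α', hα', hαv⟩ := exists_scale α hα (Units.mkOfMulEqOne v _ ((mul_comm _ _).trans hv))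
  have hU' : ⊤ ≤ ((h ≫ g₀) ≫ π) ⁻¹ᵁ U := by rwa [Category.assoc, hh]
  have hv1 (i) : value q β U hU' (e i) = h.appTop (value q α₀ U hg₀ (e i)) :=
    hβv (π ⁻¹ᵁ U) hg₀ _ _
  have hv2 (i) : value q α' U hg (e i) = v * value q α U hg (e i) := hαv (π ⁻¹ᵁ U) hg _
  have hval (i) : value q β U hU' (e i) = value q α' U hg (e i) := by
    rw [hv1, hv2, hv₀]
    split_ifs with hi
    · rw [map_one, hi, mul_comm, hv]
    · have : i = j' := by omega
      rw [happ, this, mul_comm v]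
      simp [φ]
  obtain ⟨h1, h2⟩ := hP.point_ext he hβ hα' ((Category.assoc _ _ _).trans hh) hU' hg hval
    ⟨j, by rw [hv1, hv₀, if_pos rfl, map_one]; exact isUnit_one⟩
  have h3 : evGlobal β s = evGlobal α' s := by
    clear hβv hv1 hval
    clear_value h
    subst h1
    rw [← h2]
  have h4 : evGlobal β s = h.appTop (evGlobal α₀ s) := hβv ⊤ _ _ s
  have h5 : evGlobal α' s = v * evGlobal α s := hαv ⊤ _ s
  have h6 := happ ((Scheme.ΓSpecIso R).hom (evGlobal α₀ s))
  rw [Iso.hom_inv_id_apply, ← h4, h3, h5] at h6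
  change _ = _ * φ _
  rw [← h6, ← mul_assoc, hv, one_mul]

open LaurentPolynomial in
/-- Locally on the base, the global sections of `𝒪(1)` are linear forms. -/
lemma IsProjectiveBundle.exists_linear (hP : E.IsProjectiveBundle π L q) {U : S.Opens}
    (hU : IsAffineOpen U) {e : Fin 2 → Γ(E, U)} (he : E.IsFrame U e) (s : Γ(L, ⊤)) :
    ∃ a : Fin 2 → Γ(S, U), ∀ {T : Scheme.{u}} {g : T ⟶ P}
      {α : L ⟶ (pushforward g).obj (structureModule T)}, IsTrivialization α →
      ∀ (hg : ⊤ ≤ (g ≫ π) ⁻¹ᵁ U), (∃ i, IsUnit (value q α U hg (e i))) →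
      evGlobal α s = ∑ i, (g ≫ π).appLE U ⊤ hg (a i) * value q α U hg (e i) := by
  obtain ⟨p₀, hp₀⟩ := hP.exists_polynomial hU he s (show (0 : Fin 2) ≠ 1 by decide)
  obtain ⟨p₁, hp₁⟩ := hP.exists_polynomial hU he s (show (1 : Fin 2) ≠ 0 by decide)
  obtain ⟨a, b, rfl, rfl⟩ : ∃ a b, p₀ = .C a + .C b * .X ∧ p₁ = .C b + .C a * .X := by
    apply Polynomial.exists_of_toLaurent_eq
    let R := CommRingCat.of (LaurentPolynomial Γ(S, U))
    let f₀ : Spec R ⟶ S := Spec.map (CommRingCat.ofHom C) ≫ hU.fromSpec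
    let ι := (Scheme.ΓSpecIso R).inv.hom
    have hf₀ : ⊤ ≤ f₀ ⁻¹ᵁ U := hU.le_SpecMap_fromSpec _
    obtain ⟨g, α, h₀, hα, hv⟩ := hP.exists_point he f₀ hf₀ ![1, ι (T 1)] ⟨0, by simp⟩
    have hg : ⊤ ≤ (g ≫ π) ⁻¹ᵁ U := by rwa [h₀]
    have happ : ((g ≫ π).appLE U ⊤ hg).hom = ι.comp C := by
      have : (g ≫ π).appLE U ⊤ hg = f₀.appLE U ⊤ hf₀ := by congr 1
      rw [this, hU.SpecMap_fromSpec_appLE]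
      rfl
    have hT : ι (T 1) * ι (T (-1)) = 1 := by
      rw [← map_mul, ← T_add, add_neg_cancel, T_zero, map_one]
    have h1 := hp₀ hα hg 1 (by simp [hv])
    have h2 := hp₁ hα hg (ι (T (-1))) (by simpa [hv] using hT)
    simp only [hv, happ] at h1 h2
    rw [h1] at h2
    have hι : Function.Injective ι :=
      (Scheme.ΓSpecIso R).symm.commRingCatIsoToRingEquiv.injective
    apply hι
    simp only [Matrix.cons_val_zero, Matrix.cons_val_one, one_mul, mul_one] at h2
    rw [← Polynomial.hom_eval₂, ← Polynomial.hom_eval₂, ← map_mul] at h2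
    have hC (p : Polynomial Γ(S, U)) : Polynomial.toLaurent p = p.eval₂ C (T 1) :=
      RingHom.congr_fun (Polynomial.ringHom_ext (f := Polynomial.toLaurent)
        (g := Polynomial.eval₂RingHom C (T 1)) (by simp) (by simp)) p
    rw [hC, h2, ← AlgEquiv.coe_ringEquiv, ← RingEquiv.coe_toRingHom, hC, Polynomial.hom_eval₂]
    congr 2
    congr 1
    · ext; simp
    · simp
  refine ⟨![a, b], fun {T' g α} hα hg hu ↦ ?_⟩
  have hu' : (∃ v, value q α U hg (e 0) * v = 1) ∨ (∃ v, value q α U hg (e 1) * v = 1) := by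
    obtain ⟨i, hi⟩ := hu
    have := hi.exists_right_inv
    fin_cases i
    · exact .inl this
    · exact .inr this
  rcases hu' with ⟨v, hv⟩ | ⟨v, hv⟩
  · rw [hp₀ hα hg v hv]
    simp only [Polynomial.eval₂_add, Polynomial.eval₂_mul, Polynomial.eval₂_C, Polynomial.eval₂_X,
      Fin.sum_univ_two, Matrix.cons_val_zero, Matrix.cons_val_one]
    change _ * (((g ≫ π).appLE U ⊤ hg) a + ((g ≫ π).appLE U ⊤ hg) b * _) = _
    linear_combination (((g ≫ π).appLE U ⊤ hg) b * value q α U hg (e 1)) * hv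
  · rw [hp₁ hα hg v hv]
    simp only [Polynomial.eval₂_add, Polynomial.eval₂_mul, Polynomial.eval₂_C, Polynomial.eval₂_X,
      Fin.sum_univ_two, Matrix.cons_val_zero, Matrix.cons_val_one]
    change _ * (((g ≫ π).appLE U ⊤ hg) b + ((g ≫ π).appLE U ⊤ hg) a * _) = _
    linear_combination (((g ≫ π).appLE U ⊤ hg) a * value q α U hg (e 0)) * hv

end Scheme.Modules

end AlgebraicGeometry

namespace AlgebraicGeometry.Scheme.Modules

variable {S P : Scheme.{u}} {E : S.Modules} {π : P ⟶ S} {L : P.Modules}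
  {q : (pullback π).obj E ⟶ L} {T : Scheme.{u}} {g : T ⟶ P}
  {α : L ⟶ (pushforward g).obj (structureModule T)}

lemma value_res {U V : S.Opens} (i : V ⟶ U) (hV : ⊤ ≤ (g ≫ π) ⁻¹ᵁ V) (hU : ⊤ ≤ (g ≫ π) ⁻¹ᵁ U)
    (σ : Γ(E, U)) : value q α V hV (E.presheaf.map i.op σ) = value q α U hU σ :=
  evTop_res (quotientHom q α) i hV hU σ

lemma value_smul {U : S.Opens} (hU : ⊤ ≤ (g ≫ π) ⁻¹ᵁ U) (a : Γ(S, U)) (σ : Γ(E, U)) :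
    value q α U hU (a • σ) = (g ≫ π).appLE U ⊤ hU a * value q α U hU σ :=
  evTop_smul (quotientHom q α) U hU a σ

lemma value_sum {U : S.Opens} (hU : ⊤ ≤ (g ≫ π) ⁻¹ᵁ U) {n : ℕ} (σ : Fin n → Γ(E, U)) :
    value q α U hU (∑ i, σ i) = ∑ i, value q α U hU (σ i) :=
  map_sum (evTop (quotientHom q α) U hU) _ _

lemma IsFrame.value_eq {U V : S.Opens} {n : ℕ} {e : Fin n → Γ(E, U)} (he : E.IsFrame U e)
    (h : V ≤ U) (hV : ⊤ ≤ (g ≫ π) ⁻¹ᵁ V) (hU : ⊤ ≤ (g ≫ π) ⁻¹ᵁ U) (σ : Γ(E, V)) :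
    value q α V hV σ = ∑ i, (g ≫ π).appLE V ⊤ hV (he.coord h σ i) * value q α U hU (e i) := by
  conv_lhs => rw [← he.sum_coord h σ]
  rw [value_sum]
  simp only [value_smul, value_res _ hV hU]

lemma le_preimage_fromSpecStalk {U : S.Opens} {x : S} (hx : x ∈ U) :
    ⊤ ≤ S.fromSpecStalk x ⁻¹ᵁ U := by
  intro y _
  have : S.fromSpecStalk x y ∈ Set.range (S.fromSpecStalk x) := ⟨y, rfl⟩
  rw [Scheme.range_fromSpecStalk] at this
  exact this.mem_open U.2 hx

lemma fromSpecStalk_appLE {U : S.Opens} {x : S} (hx : x ∈ U) (h : ⊤ ≤ S.fromSpecStalk x ⁻¹ᵁ U) :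
    (S.fromSpecStalk x).appLE U ⊤ h =
      S.presheaf.germ U x hx ≫ (Scheme.ΓSpecIso (S.presheaf.stalk x)).inv := by
  rw [Scheme.Hom.appLE, Scheme.fromSpecStalk_app hx, Category.assoc, Category.assoc,
    ← Functor.map_comp]
  congr 1

lemma isLocalRing_Γ_Spec (R : CommRingCat.{u}) [IsLocalRing R] : IsLocalRing Γ(Spec R, ⊤) :=
  (Scheme.ΓSpecIso R).symm.commRingCatIsoToRingEquiv.isLocalRing

lemma _root_.IsLocalRing.exists_isUnit_of_sum {R : Type*} [CommRing R] [IsLocalRing R]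
    (a b : Fin 2 → R) (h : IsUnit (∑ i, a i * b i)) : ∃ i, IsUnit (b i) := by
  rw [Fin.sum_univ_two] at h
  rcases IsLocalRing.isUnit_or_isUnit_of_isUnit_add h with h | h
  exacts [⟨0, isUnit_of_mul_isUnit_right h⟩, ⟨1, isUnit_of_mul_isUnit_right h⟩]

/-- The global sections of `𝒪(1)` on `ℙ(E)` come from global sections of `E`. -/
lemma IsProjectiveBundle.exists_section (hP : E.IsProjectiveBundle π L q) {U : S → S.Opens}
    (hU : ∀ x, IsAffineOpen (U x)) (hxU : ∀ x, x ∈ U x) {e : ∀ x, Fin 2 → Γ(E, U x)}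
    (he : ∀ x, E.IsFrame (U x) (e x)) (s : Γ(L, ⊤)) :
    ∃ σ : Γ(E, ⊤), ∀ (x : S) {T : Scheme.{u}} {g : T ⟶ P}
      {α : L ⟶ (pushforward g).obj (structureModule T)}, IsTrivialization α →
      ∀ (hg : ⊤ ≤ (g ≫ π) ⁻¹ᵁ U x), (∃ i, IsUnit (value q α (U x) hg (e x i))) →
      evGlobal α s = value q α ⊤ le_rfl σ := by
  choose a ha using fun x ↦ hP.exists_linear (hU x) (he x) s
  let σ (x : S) : Γ(E, U x) := ∑ i, a x i • e x i
  have hσ (x : S) {T : Scheme.{u}} {g : T ⟶ P}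
      {α : L ⟶ (pushforward g).obj (structureModule T)} (hα : IsTrivialization α)
      (hg : ⊤ ≤ (g ≫ π) ⁻¹ᵁ U x) (hu : ∃ i, IsUnit (value q α (U x) hg (e x i))) :
      evGlobal α s = value q α (U x) hg (σ x) := by
    rw [ha x hα hg hu, value_sum]
    simp only [value_smul]
  have hcompat (x y : S) : E.presheaf.map (homOfLE (inf_le_left : U x ⊓ U y ≤ U x)).op (σ x) =
      E.presheaf.map (homOfLE (inf_le_right : U x ⊓ U y ≤ U y)).op (σ y) := by
    apply ((he x).coord inf_le_left).injective
    ext i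
    refine TopCat.Presheaf.section_ext S.sheaf _ _ _ fun z hz ↦ ?_
    have hV := le_preimage_fromSpecStalk hz
    have hf := le_preimage_fromSpecStalk hz.1
    have hf' := le_preimage_fromSpecStalk hz.2
    obtain ⟨g, α, h₀, hα, hv⟩ := hP.exists_point (he x) (S.fromSpecStalk z) hf (Pi.single i 1)
      ⟨i, by simp⟩
    have hg : ⊤ ≤ (g ≫ π) ⁻¹ᵁ U x := by rwa [h₀]
    have hg' : ⊤ ≤ (g ≫ π) ⁻¹ᵁ U y := by rwa [h₀]
    have hgV : ⊤ ≤ (g ≫ π) ⁻¹ᵁ (U x ⊓ U y) := by rwa [h₀]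
    have hu : ∃ j, IsUnit (value q α (U y) hg' (e y j)) := by
      have h1 := value_res (q := q) (α := α) (homOfLE (inf_le_left : U x ⊓ U y ≤ U x)) hgV hg (e x i)
      rw [hv, Pi.single_eq_same, (he y).value_eq inf_le_right hgV hg'] at h1
      have := isLocalRing_Γ_Spec (S.presheaf.stalk z)
      exact IsLocalRing.exists_isUnit_of_sum _ _ (h1.symm ▸ isUnit_one)
    have h1 := hσ x hα hg ⟨i, by simp [hv]⟩
    rw [hσ y hα hg' hu, ← value_res (homOfLE (inf_le_left : U x ⊓ U y ≤ U x)) hgV,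
      ← value_res (homOfLE (inf_le_right : U x ⊓ U y ≤ U y)) hgV,
      (he x).value_eq inf_le_left hgV hg, (he x).value_eq inf_le_left hgV hg] at h1
    simp only [hv, Pi.single_apply, mul_ite, mul_one, mul_zero, Finset.sum_ite_eq',
      Finset.mem_univ, if_true] at h1
    have happ : (g ≫ π).appLE (U x ⊓ U y) ⊤ hgV = (S.fromSpecStalk z).appLE (U x ⊓ U y) ⊤ hV := by
      congr 1
    rw [happ, fromSpecStalk_appLE hz] at h1
    exact ((Scheme.ΓSpecIso (S.presheaf.stalk z)).symm.commRingCatIsoToRingEquiv.injective h1).symm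
  obtain ⟨τ, hτ, -⟩ := TopCat.Sheaf.existsUnique_gluing' ⟨E.presheaf, E.isSheaf⟩ U ⊤
    (fun x ↦ homOfLE le_top) (fun x _ ↦ Opens.mem_iSup.2 ⟨x, hxU x⟩) σ hcompat
  refine ⟨τ, fun x T g α hα hg hu ↦ ?_⟩
  rw [hσ x hα hg hu, ← hτ x]
  exact value_res _ _ _ _

end AlgebraicGeometry.Scheme.Modules

lemma AlgebraicGeometry.Proj.basicOpenToSpec_awayι {σ A : Type u} [CommRing A] [SetLike σ A]
    [AddSubgroupClass σ A] (𝒜 : ℕ → σ) [GradedRing 𝒜] {f : A} {m : ℕ} (hf : f ∈ 𝒜 m) (hm : 0 < m) :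
    (basicOpen 𝒜 f).toSpecΓ ≫ Spec.map (awayToSection 𝒜 f) ≫ awayι 𝒜 f hf hm =
      (basicOpen 𝒜 f).ι := by
  rw [awayι, ← Category.assoc]
  change basicOpenToSpec _ _ ≫ _ = _
  rw [← basicOpenIsoSpec_hom _ _ hf hm, Iso.hom_inv_id_assoc]

namespace AlgebraicGeometry.PSpace

variable {k : Type u} [Field k] {n : ℕ}

variable (k) in
/-- The element `xᵢ / xⱼ` of the coordinate ring of `D₊(xⱼ)`. -/
def awayRatio (i j : Fin (n + 1)) :
    HomogeneousLocalization.Away (MvPolynomial.homogeneousSubmodule (Fin (n + 1)) k)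
      (MvPolynomial.X j) :=
  HomogeneousLocalization.Away.mk (MvPolynomial.homogeneousSubmodule (Fin (n + 1)) k)
    ((MvPolynomial.mem_homogeneousSubmodule 1 _).2 (MvPolynomial.isHomogeneous_X k j)) 1
    (MvPolynomial.X i) (by
      rw [one_smul]
      exact (MvPolynomial.mem_homogeneousSubmodule 1 _).2 (MvPolynomial.isHomogeneous_X k i))

variable (k) in
/-- The constants in the coordinate ring of `D₊(xⱼ)`. -/
def awayC (j : Fin (n + 1)) :
    k →+* HomogeneousLocalization.Away (MvPolynomial.homogeneousSubmodule (Fin (n + 1)) k)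
      (MvPolynomial.X j) :=
  (HomogeneousLocalization.fromZeroRingHom _ _).comp
    (algebraMap k (MvPolynomial.homogeneousSubmodule (Fin (n + 1)) k 0))

lemma away_mk_eq (j : Fin (n + 1)) (m : ℕ) (p : MvPolynomial (Fin (n + 1)) k) (hp) :
    HomogeneousLocalization.Away.mk (MvPolynomial.homogeneousSubmodule (Fin (n + 1)) k)
      ((MvPolynomial.mem_homogeneousSubmodule 1 _).2 (MvPolynomial.isHomogeneous_X k j)) m p hp =
      MvPolynomial.eval₂ (awayC k j) (fun i ↦ awayRatio k i j) p := by
  apply HomogeneousLocalization.val_injective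
  have hp' : p.IsHomogeneous m := by simpa using hp
  rw [HomogeneousLocalization.Away.val_mk, ← HomogeneousLocalization.algebraMap_apply,
    MvPolynomial.hom_eval₂]
  rw [Localization.mk_eq_mk'_apply, IsLocalization.mk'_eq_iff_eq_mul]
  have hC : (algebraMap _ (Localization.Away (MvPolynomial.X (R := k) j))).comp (awayC k j) =
      algebraMap k (Localization.Away (MvPolynomial.X (R := k) j)) := by
    ext c
    change Localization.mk _ 1 = _
    rw [Localization.mk_one_eq_algebraMap]
    rfl
  have hX (i) : algebraMap (MvPolynomial (Fin (n + 1)) k)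
      (Localization.Away (MvPolynomial.X (R := k) j)) (MvPolynomial.X i) =
      algebraMap _ (Localization.Away (MvPolynomial.X (R := k) j)) (awayRatio k i j) *
        algebraMap (MvPolynomial (Fin (n + 1)) k) (Localization.Away (MvPolynomial.X (R := k) j))
          (MvPolynomial.X j) := by
    rw [HomogeneousLocalization.algebraMap_apply, awayRatio,
      HomogeneousLocalization.Away.val_mk, Localization.mk_eq_mk'_apply]
    simp
  rw [hC]
  conv_lhs => rw [← MvPolynomial.eval₂_eta p]
  rw [MvPolynomial.hom_eval₂, MvPolynomial.eval₂_eq, MvPolynomial.eval₂_eq, Finset.sum_mul]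
  refine Finset.sum_congr rfl fun d hd ↦ ?_
  rw [mul_assoc]
  congr 1
  rw [Finset.prod_congr rfl fun i _ ↦ congrArg (· ^ d i) (hX i)]
  simp only [mul_pow, Finset.prod_mul_distrib, Finset.prod_pow_eq_pow_sum, map_pow]
  congr 2
  exact (hp'.degree_eq_sum_deg_support hd).symm

lemma away_ringHom_ext {R : Type*} [CommRing R] {j : Fin (n + 1)}
    {F G : HomogeneousLocalization.Away (MvPolynomial.homogeneousSubmodule (Fin (n + 1)) k)
      (MvPolynomial.X j) →+* R} (hC : F.comp (awayC k j) = G.comp (awayC k j))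
    (hX : ∀ i, F (awayRatio k i j) = G (awayRatio k i j)) : F = G := by
  ext a
  obtain ⟨m, p, hp, rfl⟩ := HomogeneousLocalization.Away.mk_surjective _
    ((MvPolynomial.mem_homogeneousSubmodule 1 _).2 (MvPolynomial.isHomogeneous_X k j)) a
  rw [away_mk_eq, MvPolynomial.hom_eval₂, MvPolynomial.hom_eval₂, hC]
  congr 1
  exact funext hX

/-- The open immersion of `D₊(xⱼ)`. -/
def chartι (j : Fin (n + 1)) : Spec (.of (HomogeneousLocalization.Away
    (MvPolynomial.homogeneousSubmodule (Fin (n + 1)) k) (MvPolynomial.X j))) ⟶ PSpace k n :=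
  Proj.awayι _ _ ((MvPolynomial.mem_homogeneousSubmodule 1 _).2 (MvPolynomial.isHomogeneous_X k j))
    zero_lt_one

variable {T : Scheme.{u}}

/-- The identification of the coordinate ring of `D₊(xⱼ)`. -/
def awayToChart (j : Fin (n + 1)) : CommRingCat.of (HomogeneousLocalization.Away
    (MvPolynomial.homogeneousSubmodule (Fin (n + 1)) k) (MvPolynomial.X j)) ⟶
      Γ(PSpace k n, chart k j) :=
  Proj.awayToSection (MvPolynomial.homogeneousSubmodule (Fin (n + 1)) k) (MvPolynomial.X j)

/-- The map on functions induced by a morphism to the chart `D₊(xⱼ)`. -/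
def chartHom {j : Fin (n + 1)} (ψ : T ⟶ PSpace k n) (h : ⊤ ≤ ψ ⁻¹ᵁ chart k j) :
    CommRingCat.of (HomogeneousLocalization.Away
      (MvPolynomial.homogeneousSubmodule (Fin (n + 1)) k) (MvPolynomial.X j)) ⟶ Γ(T, ⊤) :=
  awayToChart j ≫ ψ.appLE (chart k j) ⊤ h

lemma toSpecΓ_SpecMap_chartHom {j : Fin (n + 1)} (ψ : T ⟶ PSpace k n) (h : ⊤ ≤ ψ ⁻¹ᵁ chart k j) :
    T.toSpecΓ ≫ Spec.map (chartHom ψ h) ≫ chartι j = ψ := by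
  have : IsIso (⊤ : T.Opens).ι := inferInstanceAs (IsIso T.topIso.hom)
  rw [← cancel_epi (⊤ : T.Opens).ι, ← Category.assoc, ← Scheme.Opens.toSpecΓ_top, chartHom,
    Spec.map_comp_assoc, Scheme.Opens.toSpecΓ_SpecMap_appLE_assoc]
  have h1 : (chart k j).toSpecΓ ≫ Spec.map (awayToChart j) ≫ chartι j =
      (chart k j).ι :=
    Proj.basicOpenToSpec_awayι _ _ _
  rw [h1, Scheme.Hom.resLE_comp_ι]

lemma toSpecΓ_comp_injective {R : CommRingCat.{u}} {a b : R ⟶ Γ(T, ⊤)}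
    (h : T.toSpecΓ ≫ Spec.map a = T.toSpecΓ ≫ Spec.map b) : a = b := by
  have := congrArg (fun φ ↦ (Scheme.ΓSpecIso R).inv ≫ φ.appTop) h
  simp only [Scheme.Hom.comp_appTop, ← Scheme.ΓSpecIso_inv_naturality_assoc,
    Scheme.toSpecΓ_appTop, Iso.inv_hom_id, Category.comp_id] at this
  exact this

lemma hom_ext_of_chart {j : Fin (n + 1)} {ψ ψ' : T ⟶ PSpace k n}
    (hk : ψ ≫ toSpec k n = ψ' ≫ toSpec k n) (h : ⊤ ≤ ψ ⁻¹ᵁ chart k j) (h' : ⊤ ≤ ψ' ⁻¹ᵁ chart k j)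
    (hr : ∀ i, ψ.appLE _ ⊤ h (ratio k i j) = ψ'.appLE _ ⊤ h' (ratio k i j)) : ψ = ψ' := by
  have key (ψ : T ⟶ PSpace k n) (h : ⊤ ≤ ψ ⁻¹ᵁ chart k j) :
      ψ ≫ toSpec k n = T.toSpecΓ ≫ Spec.map (CommRingCat.ofHom (awayC k j) ≫ chartHom ψ h) := by
    conv_lhs => rw [← toSpecΓ_SpecMap_chartHom ψ h]
    rw [Spec.map_comp, Category.assoc, Category.assoc]
    congr 2
    rw [chartι, toSpec]
    erw [Proj.awayι_toSpecZero_assoc]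
    rw [← Spec.map_comp]
    rfl
  have hC : CommRingCat.ofHom (awayC k j) ≫ chartHom ψ h =
      CommRingCat.ofHom (awayC k j) ≫ chartHom ψ' h' :=
    toSpecΓ_comp_injective ((key ψ h).symm.trans (hk.trans (key ψ' h')))
  rw [← toSpecΓ_SpecMap_chartHom ψ h, ← toSpecΓ_SpecMap_chartHom ψ' h']
  congr 3
  exact CommRingCat.hom_ext (away_ringHom_ext (congrArg CommRingCat.Hom.hom hC) hr)

lemma le_preimage_chart {i j : Fin (n + 1)} {ψ : T ⟶ PSpace k n} (h : ⊤ ≤ ψ ⁻¹ᵁ chart k j)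
    (hu : IsUnit (ψ.appLE _ ⊤ h (ratio k i j))) : ⊤ ≤ ψ ⁻¹ᵁ chart k i := by
  intro x _
  rw [← toSpecΓ_SpecMap_chartHom ψ h]
  change T.toSpecΓ x ∈ Spec.map (chartHom ψ h) ⁻¹ᵁ chartι j ⁻¹ᵁ chart k i
  have := Proj.awayι_preimage_basicOpen (MvPolynomial.homogeneousSubmodule (Fin (n + 1)) k)
    ((MvPolynomial.mem_homogeneousSubmodule 1 _).2 (MvPolynomial.isHomogeneous_X k j)) zero_lt_one
    ((MvPolynomial.mem_homogeneousSubmodule 1 _).2 (MvPolynomial.isHomogeneous_X k i)) zero_lt_one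
  rw [chartι, chart]
  erw [this]
  have h1 : HomogeneousLocalization.Away.isLocalizationElem
    ((MvPolynomial.mem_homogeneousSubmodule 1 _).2 (MvPolynomial.isHomogeneous_X k j))
    ((MvPolynomial.mem_homogeneousSubmodule 1 _).2 (MvPolynomial.isHomogeneous_X k i)) =
      awayRatio k i j := by
    simp [HomogeneousLocalization.Away.isLocalizationElem, awayRatio]
  rw [h1]
  change _ ∉ _
  exact fun hx ↦ (T.toSpecΓ x).2.ne_top (Ideal.eq_top_of_isUnit_mem _ hx hu)

variable (k n) in
lemma iSup_chart : ⨆ j, chart k (n := n) j = ⊤ := by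
  refine Proj.iSup_basicOpen_eq_top' _ _ (fun i ↦ ⟨1,
    (MvPolynomial.mem_homogeneousSubmodule 1 _).2 (MvPolynomial.isHomogeneous_X k i)⟩) ?_
  rw [eq_top_iff]
  intro p _
  have : p ∈ Algebra.adjoin k (Set.range (MvPolynomial.X : Fin (n + 1) → MvPolynomial (Fin (n + 1)) k)) := by
    rw [MvPolynomial.adjoin_range_X]; trivial
  induction this using Algebra.adjoin_induction with
  | mem x hx => exact Algebra.subset_adjoin hx
  | algebraMap r => exact Subalgebra.algebraMap_mem _ (algebraMap k (MvPolynomial.homogeneousSubmodule (Fin (n + 1)) k 0) r)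
  | add x y _ _ hx hy => exact add_mem (hx trivial) (hy trivial)
  | mul x y _ _ hx hy => exact mul_mem (hx trivial) (hy trivial)

lemma exists_le_preimage_chart {R : CommRingCat.{u}} [IsLocalRing R] (ψ : Spec R ⟶ PSpace k n) :
    ∃ j, ⊤ ≤ ψ ⁻¹ᵁ chart k j := by
  have : ψ (IsLocalRing.closedPoint R) ∈ ⨆ j, chart k (n := n) j := by
    rw [iSup_chart]; trivial
  obtain ⟨j, hj⟩ := Opens.mem_iSup.1 this
  exact ⟨j, ((IsLocalRing.closed_point_mem_iff (U := ψ ⁻¹ᵁ chart k j)).1 hj).ge⟩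

end AlgebraicGeometry.PSpace

namespace AlgebraicGeometry.Scheme.Modules

namespace IsMorphismOfSections

variable {k : Type u} [Field k] {n : ℕ} {P : Scheme.{u}} {L : P.Modules}
  {s : Fin (n + 1) → Γ(L, ⊤)} {φ : P ⟶ PSpace k n} (H : L.IsMorphismOfSections s φ)
  {T : Scheme.{u}} {g g' : T ⟶ P} {α : L ⟶ (pushforward g).obj (structureModule T)}
  {α' : L ⟶ (pushforward g').obj (structureModule T)}

include H

lemma isUnit_evGlobal {j : Fin (n + 1)} (hj : ⊤ ≤ (g ≫ φ) ⁻¹ᵁ PSpace.chart k j)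
    (hu : ∃ (V : P.Opens) (hV : ⊤ ≤ g ⁻¹ᵁ V) (τ : Γ(L, V)), IsUnit (evTop α V hV τ)) :
    IsUnit (evGlobal α (s j)) := by
  obtain ⟨V, hV, τ, hτ⟩ := hu
  have hV' : ⊤ ≤ g ⁻¹ᵁ (V ⊓ φ ⁻¹ᵁ PSpace.chart k j) := le_inf hV hj
  obtain ⟨a, ha⟩ := (H.bijective_smul j (V ⊓ φ ⁻¹ᵁ PSpace.chart k j) inf_le_right).2
    (L.presheaf.map (homOfLE inf_le_left).op τ)
  have h1 := evTop_res α (homOfLE (inf_le_left : V ⊓ φ ⁻¹ᵁ PSpace.chart k j ≤ V)) hV' hV τ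
  rw [← ha, evTop_smul, globalRes, evTop_res α _ _ le_rfl] at h1
  exact isUnit_of_mul_isUnit_right (h1 ▸ hτ)

lemma evGlobal_eq (i : Fin (n + 1)) {j : Fin (n + 1)}
    (hj : ⊤ ≤ (g ≫ φ) ⁻¹ᵁ PSpace.chart k j) :
    evGlobal α (s i) = (g ≫ φ).appLE _ ⊤ hj (PSpace.ratio k i j) * evGlobal α (s j) := by
  have hj' : ⊤ ≤ g ⁻¹ᵁ φ ⁻¹ᵁ PSpace.chart k j := hj
  have h1 := (congrArg (evTop α (φ ⁻¹ᵁ PSpace.chart k j) hj') (H.eq_smul i j)).trans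
    (evTop_smul α (φ ⁻¹ᵁ PSpace.chart k j) hj' _ _)
  rw [globalRes, globalRes, evTop_res α _ _ le_rfl, evTop_res α _ _ le_rfl] at h1
  rw [evGlobal, h1, Scheme.Hom.comp_appLE]
  rfl

/-- Points of a subscheme of projective space with the same homogeneous coordinates agree. -/
lemma eq_of_evGlobal_eq [Mono φ] {R : CommRingCat.{u}} [IsLocalRing R] {g g' : Spec R ⟶ P}
    {α : L ⟶ (pushforward g).obj (structureModule _)}
    {α' : L ⟶ (pushforward g').obj (structureModule _)}
    (hk : (g ≫ φ) ≫ PSpace.toSpec k n = (g' ≫ φ) ≫ PSpace.toSpec k n)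
    (hu : ∃ (V : P.Opens) (hV : ⊤ ≤ g ⁻¹ᵁ V) (τ : Γ(L, V)), IsUnit (evTop α V hV τ))
    (hs : ∀ i, evGlobal α (s i) = evGlobal α' (s i)) : g = g' := by
  obtain ⟨j, hj⟩ := PSpace.exists_le_preimage_chart (g ≫ φ)
  obtain ⟨l, hl⟩ := PSpace.exists_le_preimage_chart (g' ≫ φ)
  have hj1 := H.isUnit_evGlobal hj hu
  have hj' : ⊤ ≤ (g' ≫ φ) ⁻¹ᵁ PSpace.chart k j := by
    refine PSpace.le_preimage_chart hl ?_
    rw [hs, H.evGlobal_eq j hl] at hj1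
    exact isUnit_of_mul_isUnit_left hj1
  refine (cancel_mono φ).1 (PSpace.hom_ext_of_chart hk hj hj' fun i ↦ ?_)
  rw [← hj1.mul_left_inj, ← H.evGlobal_eq i hj, hs i, hs j, ← H.evGlobal_eq i hj']

end IsMorphismOfSections

end AlgebraicGeometry.Scheme.Modules

namespace AlgebraicGeometry.Scheme.Modules

variable {S : Scheme.{u}} {E : S.Modules} {U : S.Opens} {n : ℕ} {e : Fin n → Γ(E, U)}

/-- The coordinates of the germ at `x` of a global section. -/
def IsFrame.stalkCoord (he : E.IsFrame U e) {x : S} (hx : x ∈ U) :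
    Γ(E, ⊤) →+ (Fin n → S.presheaf.stalk x) where
  toFun σ i := S.presheaf.germ U x hx (he.coord le_rfl (E.globalRes U σ) i)
  map_zero' := by ext; simp [globalRes]
  map_add' σ τ := by ext; simp [globalRes]

lemma IsFrame.stalkCoord_apply (he : E.IsFrame U e) {x : S} (hx : x ∈ U) (σ : Γ(E, ⊤)) (i : Fin n) :
    he.stalkCoord hx σ i = S.presheaf.germ U x hx (he.coord le_rfl (E.globalRes U σ) i) := rfl

lemma IsFrame.stalkCoord_smul (he : E.IsFrame U e) {x : S} (hx : x ∈ U) (a : Γ(S, ⊤)) (σ : Γ(E, ⊤))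
    (i : Fin n) :
    he.stalkCoord hx (a • σ) i = S.presheaf.germ ⊤ x (Opens.mem_top x) a * he.stalkCoord hx σ i := by
  have h : E.globalRes U (a • σ) = S.presheaf.map (homOfLE le_top).op a • E.globalRes U σ :=
    E.map_smul (homOfLE le_top) a σ
  rw [stalkCoord_apply, h, _root_.map_smul, Pi.smul_apply, smul_eq_mul, map_mul, stalkCoord_apply,
    TopCat.Presheaf.germ_res_apply]

lemma le_preimage_SpecMap_fromSpecStalk {x : S} (hx : x ∈ U) {R : CommRingCat.{u}}
    (ρ : S.presheaf.stalk x ⟶ R) : ⊤ ≤ (Spec.map ρ ≫ S.fromSpecStalk x) ⁻¹ᵁ U :=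
  fun _ _ ↦ le_preimage_fromSpecStalk hx trivial

lemma appLE_top_top {X Y : Scheme.{u}} (f : X ⟶ Y) (h) : f.appLE ⊤ ⊤ h = f.appTop :=
  f.app_eq_appLE.symm

lemma SpecMap_fromSpecStalk_appLE {x : S} (hx : x ∈ U) {R : CommRingCat.{u}}
    (ρ : S.presheaf.stalk x ⟶ R) (h : ⊤ ≤ (Spec.map ρ ≫ S.fromSpecStalk x) ⁻¹ᵁ U) :
    (Spec.map ρ ≫ S.fromSpecStalk x).appLE U ⊤ h =
      S.presheaf.germ U x hx ≫ ρ ≫ (Scheme.ΓSpecIso R).inv := by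
  rw [← Scheme.Hom.appLE_comp_appLE _ _ U ⊤ ⊤ (le_preimage_fromSpecStalk hx) le_rfl,
    fromSpecStalk_appLE hx, Category.assoc, Scheme.ΓSpecIso_inv_naturality]
  exact congrArg (fun t ↦ S.presheaf.germ U x hx ≫ (Scheme.ΓSpecIso _).inv ≫ t)
    (appLE_top_top (Spec.map ρ) _)

lemma exists_affine_frames (hE : E.IsLocallyFreeOfRank n) :
    ∃ (U : S → S.Opens) (e : ∀ x, Fin n → Γ(E, U x)), (∀ x, IsAffineOpen (U x)) ∧
      (∀ x, x ∈ U x) ∧ ∀ x, E.IsFrame (U x) (e x) := by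
  have (x : S) : ∃ (U : S.Opens) (e : Fin n → Γ(E, U)), IsAffineOpen U ∧ x ∈ U ∧ E.IsFrame U e := by
    obtain ⟨V, hV, e, he⟩ := hE x
    obtain ⟨U, hU, hx, hUV⟩ := Opens.isBasis_iff_nbhd.1 S.isBasis_affineOpens hV
    exact ⟨U, _, hU, hx, IsFrame.mono he hUV⟩
  choose U e h using this
  exact ⟨U, e, fun x ↦ (h x).1, fun x ↦ (h x).2.1, fun x ↦ (h x).2.2⟩

/-- The constants in a local ring of a scheme over a field. -/
def stalkConst {k : Type u} [Field k] (f : S ⟶ Spec (.of k)) (x : S) :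
    CommRingCat.of k ⟶ S.presheaf.stalk x :=
  (Scheme.ΓSpecIso (.of k)).inv ≫ f.appTop ≫ S.presheaf.germ ⊤ x (Opens.mem_top x)

lemma SpecMap_fromSpecStalk_comp {k : Type u} [Field k] (f : S ⟶ Spec (.of k)) {x : S}
    {R : CommRingCat.{u}} (ρ : S.presheaf.stalk x ⟶ R) :
    (Spec.map ρ ≫ S.fromSpecStalk x) ≫ f = Spec.map (stalkConst f x ≫ ρ) := by
  refine ext_of_isAffine ?_
  have h := (appLE_top_top _ _).symm.trans
    (SpecMap_fromSpecStalk_appLE (Opens.mem_top x) ρ le_rfl)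
  rw [Scheme.Hom.comp_appTop, h, ← cancel_epi (Scheme.ΓSpecIso _).inv, ← Scheme.ΓSpecIso_inv_naturality,
    stalkConst]
  simp only [Category.assoc]

/-- A very ample vector bundle of rank two generates its fibres and separates points of the
associated projective bundle with values in local rings. -/
lemma IsVeryAmple.separates {k : Type u} [Field k] {f : S ⟶ Spec (.of k)} (hva : E.IsVeryAmple f)
    {U : S → S.Opens} (hU : ∀ x, IsAffineOpen (U x)) (hxU : ∀ x, x ∈ U x)
    {e : ∀ x, Fin 2 → Γ(E, U x)} (he : ∀ x, E.IsFrame (U x) (e x)) :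
    (∀ (x : S) (R : CommRingCat.{u}) [IsLocalRing R] (ρ : S.presheaf.stalk x ⟶ R)
      (l : Fin 2 → R), (∃ i, IsUnit (l i)) →
        ∃ σ : Γ(E, ⊤), IsUnit (∑ i, ρ ((he x).stalkCoord (hxU x) σ i) * l i)) ∧
    ∀ (x y : S) (R : CommRingCat.{u}) [IsLocalRing R] (ρ : S.presheaf.stalk x ⟶ R)
      (ρ' : S.presheaf.stalk y ⟶ R) (l l' : Fin 2 → R), (∃ i, IsUnit (l i)) → (∃ i, IsUnit (l' i)) →
      stalkConst f x ≫ ρ = stalkConst f y ≫ ρ' →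
      (∀ σ : Γ(E, ⊤), ∑ i, ρ ((he x).stalkCoord (hxU x) σ i) * l i =
        ∑ i, ρ' ((he y).stalkCoord (hxU y) σ i) * l' i) →
      Spec.map ρ ≫ S.fromSpecStalk x = Spec.map ρ' ≫ S.fromSpecStalk y := by
  obtain ⟨P, π, L, q, hP, -, n, s, φ, H, hk, hφ⟩ := hva
  choose σ hσ using fun i ↦ hP.exists_section hU hxU he (s i)
  have key (x : S) (R : CommRingCat.{u}) (ρ : S.presheaf.stalk x ⟶ R)
      (l : Fin 2 → R) (hl : ∃ i, IsUnit (l i)) : ∃ (g : Spec R ⟶ P)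
        (α : L ⟶ (pushforward g).obj (structureModule (Spec R))),
        g ≫ π = Spec.map ρ ≫ S.fromSpecStalk x ∧
        (∃ (V : P.Opens) (hV : ⊤ ≤ g ⁻¹ᵁ V) (τ : Γ(L, V)), IsUnit (evTop α V hV τ)) ∧
        ∀ i, evGlobal α (s i) =
          (Scheme.ΓSpecIso R).inv (∑ j, ρ ((he x).stalkCoord (hxU x) (σ i) j) * l j) := by
    have hf := le_preimage_SpecMap_fromSpecStalk (hxU x) ρ
    obtain ⟨g, α, h, hα, hv⟩ := hP.exists_point (he x) (Spec.map ρ ≫ S.fromSpecStalk x) hf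
      (fun i ↦ (Scheme.ΓSpecIso R).inv (l i)) (hl.imp fun i hi ↦ hi.map _)
    have hg : ⊤ ≤ (g ≫ π) ⁻¹ᵁ U x := by rwa [h]
    have hu : ∃ i, IsUnit (value q α (U x) hg (e x i)) :=
      hl.imp fun i hi ↦ by rw [hv]; exact hi.map _
    refine ⟨g, α, h, ?_, fun i ↦ ?_⟩
    · obtain ⟨i, hi⟩ := hu
      exact ⟨π ⁻¹ᵁ U x, hg, _, hi⟩
    · rw [hσ i x hα hg hu, ← value_res (homOfLE le_top) hg le_rfl (σ i),
        (he x).value_eq le_rfl hg hg, map_sum]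
      refine Finset.sum_congr rfl fun j _ ↦ ?_
      have h1 : (g ≫ π).appLE (U x) ⊤ hg = S.presheaf.germ (U x) x (hxU x) ≫ ρ ≫
          (Scheme.ΓSpecIso R).inv := by
        rw [← SpecMap_fromSpecStalk_appLE (hxU x) ρ hf]
        congr 1
      rw [hv, h1, map_mul]
      rfl
  constructor
  · intro x R _ ρ l hl
    obtain ⟨g, α, h, hu, hs⟩ := key x R ρ l hl
    obtain ⟨j, hj⟩ := PSpace.exists_le_preimage_chart (g ≫ φ)
    have := H.isUnit_evGlobal hj hu
    rw [hs] at this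
    refine ⟨σ j, ?_⟩
    simpa using this.map (Scheme.ΓSpecIso R).hom.hom
  · intro x y R _ ρ ρ' l l' hl hl' hρ hl
    obtain ⟨g, α, h, hu, hs⟩ := key x R ρ l ‹_›
    obtain ⟨g', α', h', hu', hs'⟩ := key y R ρ' l' ‹_›
    rw [← h, ← h']
    congr 1
    refine H.eq_of_evGlobal_eq (α := α) (α' := α') ?_ hu fun i ↦ by rw [hs, hs', hl]
    rw [Category.assoc, hk, Category.assoc, hk, ← Category.assoc, h, ← Category.assoc, h',
      SpecMap_fromSpecStalk_comp, SpecMap_fromSpecStalk_comp, hρ]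

end AlgebraicGeometry.Scheme.Modules

namespace IsLocalRing

lemma mem_maximalIdeal_iff_of_section {k O : Type*} [Field k] [CommRing O] [IsLocalRing O]
    {c : k →+* O} {v : O →+* k} (h : ∀ a, v (c a) = a) {a : O} : a ∈ maximalIdeal O ↔ v a = 0 := by
  constructor
  · intro ha
    have h1 : a - c (v a) ∈ maximalIdeal O := fun hu ↦ by simpa [h] using hu.map v
    by_contra h0
    have h2 : c (v a) ∈ maximalIdeal O := by simpa using sub_mem ha h1
    exact h2 ((IsUnit.mk0 _ h0).map c)
  · exact fun ha hu ↦ (hu.map v).ne_zero ha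

lemma maximalIdeal_le_of_formallyUnramified {k O A B : Type u} [Field k] [CommRing O]
    [IsLocalRing O] [CommRing A] [CommRing B] {c : k →+* O} {v : O →+* k} (h : ∀ a, v (c a) = a)
    {n : ℕ} {g : MvPolynomial (Fin n) B →+* A} (hg : g.FormallyUnramified) (loc : A →+* O)
    (hloc : ∀ {C : Type u} [CommRing C] (a b : O →+* C), a.comp loc = b.comp loc → a = b)
    (hB : ∀ b, c (v (loc (g (.C b)))) = loc (g (.C b))) :
    ∃ t : Fin n → O, (∀ i, t i ∈ maximalIdeal O) ∧
      maximalIdeal O ≤ Ideal.span (Set.range t) ⊔ maximalIdeal O ^ 2 := by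
  let t (i : Fin n) : O := loc (g (.X i)) - c (v (loc (g (.X i))))
  have ht (i) : t i ∈ maximalIdeal O := by
    rw [mem_maximalIdeal_iff_of_section h]; simp [t, h]
  refine ⟨t, ht, ?_⟩
  let I := Ideal.span (Set.range t) ⊔ maximalIdeal O ^ 2
  let a : O →+* O ⧸ I := Ideal.Quotient.mk I
  let b : O →+* O ⧸ I := (Ideal.Quotient.mk I).comp (c.comp v)
  have hab : a = b := by
    apply hloc
    algebraize [g, (a.comp loc).comp g]
    have hc : (b.comp loc).comp g = (a.comp loc).comp g := by
      ext x
      · exact congrArg (Ideal.Quotient.mk I) (hB x)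
      · refine (Ideal.Quotient.eq.2 ?_).symm
        exact Ideal.mem_sup_left (Ideal.subset_span ⟨x, rfl⟩)
    let a' : A →ₐ[MvPolynomial (Fin n) B] O ⧸ I := { a.comp loc with commutes' := fun _ ↦ rfl }
    let b' : A →ₐ[MvPolynomial (Fin n) B] O ⧸ I :=
      { b.comp loc with commutes' := RingHom.congr_fun hc }
    have key : a' = b' := by
      refine Algebra.FormallyUnramified.ext ((maximalIdeal O).map (Ideal.Quotient.mk I))
        ⟨2, ?_⟩ fun x ↦ ?_
      · rw [← Ideal.map_pow, Ideal.zero_eq_bot, Ideal.map_eq_bot_iff_le_ker, Ideal.mk_ker]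
        exact le_sup_right
      · rw [Ideal.Quotient.eq]
        change Ideal.Quotient.mk I (loc x) - Ideal.Quotient.mk I (c (v (loc x))) ∈ _
        rw [← map_sub]
        refine Ideal.mem_map_of_mem _ ?_
        rw [mem_maximalIdeal_iff_of_section h]
        simp [h]
    exact congrArg (fun f ↦ f.toRingHom) key
  intro x hx
  have := RingHom.congr_fun hab x
  rw [← Ideal.Quotient.eq_zero_iff_mem]
  refine this.trans ?_
  simp [b, (mem_maximalIdeal_iff_of_section h).1 hx]

end IsLocalRing

namespace AlgebraicGeometry.Scheme.Modules

variable {k : Type u} [Field k] {S : Scheme.{u}} (f : S ⟶ Spec (.of k)) {x : S}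

lemma exists_eval [IsAlgClosed k] [LocallyOfFiniteType f] (hx : IsClosed {x}) :
    ∃ v : S.presheaf.stalk x ⟶ .of k, stalkConst f x ≫ v = 𝟙 _ := by
  refine ⟨S.residue x ≫ (residueFieldIsoBase f x hx).hom, ?_⟩
  rw [← Category.assoc, ← Iso.eq_comp_inv, Category.id_comp]
  apply Spec.map_injective
  rw [SpecMap_residueFieldIsoBase_inv, ← SpecMap_fromSpecStalk_comp]
  rfl

lemma exists_generators {n : ℕ} [SmoothOfRelativeDimension n f] {v : S.presheaf.stalk x ⟶ .of k}
    (hv : stalkConst f x ≫ v = 𝟙 _) :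
    ∃ t : Fin n → S.presheaf.stalk x, (∀ i, t i ∈ IsLocalRing.maximalIdeal (S.presheaf.stalk x)) ∧
      IsLocalRing.maximalIdeal (S.presheaf.stalk x) ≤
        Ideal.span (Set.range t) ⊔ IsLocalRing.maximalIdeal (S.presheaf.stalk x) ^ 2 := by
  obtain ⟨W, hW, V, hV, hxV, e, hf⟩ :=
    SmoothOfRelativeDimension.exists_isStandardSmoothOfRelativeDimension (n := n) (f := f) x
  obtain ⟨g, hg, hg'⟩ := hf.exists_etale_mvPolynomial
  have hWt : W = ⊤ := by
    ext y
    have : y = f x := Subsingleton.elim (α := PrimeSpectrum k) y (f x)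
    simpa [this] using e hxV
  subst hWt
  have hv' (a : k) : v (stalkConst f x a) = a := CategoryTheory.congr_fun hv a
  refine IsLocalRing.maximalIdeal_le_of_formallyUnramified (c := (stalkConst f x).hom) (v := v.hom)
    hv' (g := g) hg'.formallyUnramified (S.presheaf.germ V x hxV).hom ?_ fun b ↦ ?_
  · intro C _ a b hab
    let := TopCat.Presheaf.algebra_section_stalk S.presheaf (⟨x, hxV⟩ : V)
    have := hV.isLocalization_stalk ⟨x, hxV⟩
    exact IsLocalization.ringHom_ext (hV.primeIdealOf ⟨x, hxV⟩).asIdeal.primeCompl hab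
  · obtain ⟨b, rfl⟩ := (Scheme.ΓSpecIso (.of k)).symm.commRingCatIsoToRingEquiv.surjective b
    have : (S.presheaf.germ V x hxV).hom (g (.C ((Scheme.ΓSpecIso (.of k)).inv b))) =
        stalkConst f x b := by
      rw [show g (.C _) = _ from RingHom.congr_fun hg ((Scheme.ΓSpecIso (.of k)).inv b), stalkConst]
      change _ = S.presheaf.germ ⊤ x (Opens.mem_top x) (f.appTop _)
      rw [← TopCat.Presheaf.germ_res_apply S.presheaf (homOfLE (le_top : V ≤ ⊤)) x hxV]
      rfl
    erw [this]
    exact congrArg (stalkConst f x) (hv' b)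

end AlgebraicGeometry.Scheme.Modules

lemma LinearMap.sum_mul_apply_single {R ι : Type*} [CommRing R] [Fintype ι] [DecidableEq ι]
    (G : (ι → R) →ₗ[R] R) (c : ι → R) : ∑ i, c i * G (Pi.single i 1) = G c := by
  conv_rhs => rw [← Finset.univ_sum_single c, map_sum]
  refine Finset.sum_congr rfl fun i _ ↦ ?_
  rw [← smul_eq_mul, ← map_smul, ← Pi.single_smul, smul_eq_mul, mul_one]

namespace AlgebraicGeometry.Scheme.Modules

variable {k : Type u} [Field k] {S : Scheme.{u}} {f : S ⟶ Spec (.of k)} {E : S.Modules}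

variable (f) in
/-- The constants among the global functions on a scheme over a field. -/
def globalConst : k →+* Γ(S, ⊤) := ((Scheme.ΓSpecIso (.of k)).inv ≫ f.appTop).hom

lemma IsFrame.stalkCoord_const_smul {U : S.Opens} {n : ℕ} {e : Fin n → Γ(E, U)}
    (he : E.IsFrame U e) {x : S} (hx : x ∈ U) (a : k) (σ : Γ(E, ⊤)) (i : Fin n) :
    he.stalkCoord hx (globalConst f a • σ) i = stalkConst f x a * he.stalkCoord hx σ i :=
  he.stalkCoord_smul hx _ σ i

lemma isUnit_iff_of_section {x : S} {v : S.presheaf.stalk x ⟶ .of k}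
    (hv : stalkConst f x ≫ v = 𝟙 _) {a : S.presheaf.stalk x} : IsUnit a ↔ v a ≠ 0 := by
  rw [← not_iff_not, not_not]
  exact IsLocalRing.mem_maximalIdeal_iff_of_section (c := (stalkConst f x).hom) (v := v.hom)
    fun a ↦ CategoryTheory.congr_fun hv a

lemma SpecMap_fromSpecStalk_closedPoint {x : S} {v : S.presheaf.stalk x ⟶ .of k}
    (hv : stalkConst f x ≫ v = 𝟙 _) :
    (Spec.map v ≫ S.fromSpecStalk x) (IsLocalRing.closedPoint k) = x := by
  have : IsLocalHom v.hom := ⟨fun a ha ↦ (isUnit_iff_of_section hv).2 ha.ne_zero⟩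
  have h1 : Spec.map v (IsLocalRing.closedPoint k) = IsLocalRing.closedPoint (S.presheaf.stalk x) :=
    IsLocalRing.comap_closedPoint v.hom
  change S.fromSpecStalk x (Spec.map v _) = x
  rw [h1]
  exact Scheme.fromSpecStalk_closedPoint

namespace IsVeryAmple

variable (hva : E.IsVeryAmple f)
    {U : S → S.Opens} (hU : ∀ x, IsAffineOpen (U x)) (hxU : ∀ x, x ∈ U x)
    {e : ∀ x, Fin 2 → Γ(E, U x)} (he : ∀ x, E.IsFrame (U x) (e x))

include hva hU

/-- A very ample bundle is generated by its global sections. -/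
lemma exists_eval_eq {x : S} {v : S.presheaf.stalk x ⟶ .of k} (hv : stalkConst f x ≫ v = 𝟙 _)
    (a : Fin 2 → k) : ∃ σ : Γ(E, ⊤), ∀ i, v ((he x).stalkCoord (hxU x) σ i) = a i := by
  let V : Submodule k (Fin 2 → k) :=
    { carrier := Set.range fun σ i ↦ v ((he x).stalkCoord (hxU x) σ i)
      add_mem' := by
        rintro _ _ ⟨σ, rfl⟩ ⟨τ, rfl⟩
        exact ⟨σ + τ, by ext; simp⟩
      zero_mem' := ⟨0, by ext; simp⟩
      smul_mem' := by
        rintro a _ ⟨σ, rfl⟩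
        refine ⟨globalConst f a • σ, funext fun i ↦ ?_⟩
        simp only [IsFrame.stalkCoord_const_smul, map_mul, Pi.smul_apply, smul_eq_mul]
        congr 1
        exact CategoryTheory.congr_fun hv a }
  suffices h : V = ⊤ by
    obtain ⟨σ, hσ⟩ : a ∈ V := h ▸ trivial
    exact ⟨σ, fun i ↦ congrFun hσ i⟩
  by_contra hV
  obtain ⟨F, hF, hVF⟩ := Submodule.exists_le_ker_of_lt_top V (lt_top_iff_ne_top.2 hV)
  obtain ⟨i, hi⟩ : ∃ i, F (Pi.single i 1) ≠ 0 := by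
    by_contra! h
    exact hF (LinearMap.pi_ext' fun i ↦ LinearMap.ext_ring (h i))
  obtain ⟨σ, hσ⟩ := (hva.separates hU hxU he).1 x (.of k) v (fun i ↦ F (Pi.single i 1))
    ⟨i, IsUnit.mk0 _ hi⟩
  refine hσ.ne_zero ?_
  exact (LinearMap.sum_mul_apply_single F _).trans (hVF ⟨σ, rfl⟩)

/-- A very ample bundle separates points. -/
lemma exists_eval_eq_eval_eq {x y : S} (hxy : x ≠ y) {v : S.presheaf.stalk x ⟶ .of k}
    (hv : stalkConst f x ≫ v = 𝟙 _) {w : S.presheaf.stalk y ⟶ .of k}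
    (hw : stalkConst f y ≫ w = 𝟙 _) (a b : Fin 2 → k) :
    ∃ σ : Γ(E, ⊤), (∀ i, v ((he x).stalkCoord (hxU x) σ i) = a i) ∧
      ∀ i, w ((he y).stalkCoord (hxU y) σ i) = b i := by
  let V : Submodule k ((Fin 2 → k) × (Fin 2 → k)) :=
    { carrier := Set.range fun σ ↦ (fun i ↦ v ((he x).stalkCoord (hxU x) σ i),
        fun i ↦ w ((he y).stalkCoord (hxU y) σ i))
      add_mem' := by
        rintro _ _ ⟨σ, rfl⟩ ⟨τ, rfl⟩
        exact ⟨σ + τ, by ext <;> simp⟩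
      zero_mem' := ⟨0, by ext <;> simp⟩
      smul_mem' := by
        rintro a _ ⟨σ, rfl⟩
        refine ⟨globalConst f a • σ, Prod.ext (funext fun i ↦ ?_) (funext fun i ↦ ?_)⟩
        · simp only [IsFrame.stalkCoord_const_smul, map_mul, Prod.smul_fst, Pi.smul_apply,
            smul_eq_mul]
          congr 1
          exact CategoryTheory.congr_fun hv a
        · simp only [IsFrame.stalkCoord_const_smul, map_mul, Prod.smul_snd, Pi.smul_apply,
            smul_eq_mul]
          congr 1
          exact CategoryTheory.congr_fun hw a }
  suffices h : V = ⊤ by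
    obtain ⟨σ, hσ⟩ : (a, b) ∈ V := h ▸ trivial
    exact ⟨σ, fun i ↦ congrFun (congrArg Prod.fst hσ) i, fun i ↦ congrFun (congrArg Prod.snd hσ) i⟩
  by_contra hV
  obtain ⟨F, hF, hVF⟩ := Submodule.exists_le_ker_of_lt_top V (lt_top_iff_ne_top.2 hV)
  let F₁ := F.comp (LinearMap.inl k _ _)
  let F₂ := F.comp (LinearMap.inr k _ _)
  have hF12 (p) : F p = F₁ p.1 + F₂ p.2 := by simp [F₁, F₂, ← map_add]
  have hsum (G : (Fin 2 → k) →ₗ[k] k) := LinearMap.sum_mul_apply_single G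
  have hex (G : (Fin 2 → k) →ₗ[k] k) (hG : G ≠ 0) : ∃ i, IsUnit (G (Pi.single i 1)) := by
    by_contra! h
    exact hG (LinearMap.pi_ext' fun i ↦ LinearMap.ext_ring (by simpa using h i))
  have h0 (σ : Γ(E, ⊤)) : F₁ (fun i ↦ v ((he x).stalkCoord (hxU x) σ i)) =
      (-F₂) (fun i ↦ w ((he y).stalkCoord (hxU y) σ i)) := by
    have := hVF ⟨σ, rfl⟩
    rw [LinearMap.mem_ker, hF12] at this
    exact eq_neg_of_add_eq_zero_left this
  obtain ⟨hgen, hsep⟩ := hva.separates hU hxU he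
  have h1 : F₁ = 0 → -F₂ = 0 := fun h ↦ by
    by_contra h2
    obtain ⟨σ, hσ⟩ := hgen y (.of k) w _ (hex _ h2)
    have h3 := hsum (-F₂) (fun i ↦ w ((he y).stalkCoord (hxU y) σ i))
    rw [← h0 σ, h, LinearMap.zero_apply] at h3
    exact hσ.ne_zero h3
  have h2 : -F₂ = 0 → F₁ = 0 := fun h ↦ by
    by_contra h2
    obtain ⟨σ, hσ⟩ := hgen x (.of k) v _ (hex _ h2)
    have h3 := hsum F₁ (fun i ↦ v ((he x).stalkCoord (hxU x) σ i))
    rw [h0 σ, h, LinearMap.zero_apply] at h3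
    exact hσ.ne_zero h3
  by_cases h : F₁ = 0
  · exact hF (LinearMap.ext fun p ↦ by rw [hF12, h, neg_eq_zero.1 (h1 h)]; simp)
  · have := hsep x y (.of k) v w _ _ (hex _ h) (hex _ (mt h2 h)) (hv.trans hw.symm)
      fun σ ↦ (hsum _ _).trans ((h0 σ).trans (hsum _ _).symm)
    apply hxy
    rw [← SpecMap_fromSpecStalk_closedPoint hv, this, SpecMap_fromSpecStalk_closedPoint hw]

end IsVeryAmple

end AlgebraicGeometry.Scheme.Modules

namespace AlgebraicGeometry.Scheme.Modules.IsVeryAmple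

variable {k : Type u} [Field k] {S : Scheme.{u}} {f : S ⟶ Spec (.of k)} {E : S.Modules}

/-- A very ample bundle separates tangent vectors in each direction of a fibre. -/
lemma exists_sub_mem_sq (hva : E.IsVeryAmple f)
    {U : S → S.Opens} (hU : ∀ x, IsAffineOpen (U x)) (hxU : ∀ x, x ∈ U x)
    {e : ∀ x, Fin 2 → Γ(E, U x)} (he : ∀ x, E.IsFrame (U x) (e x))
    {x : S} {v : S.presheaf.stalk x ⟶ .of k} (hv : stalkConst f x ≫ v = 𝟙 _)
    {l : Fin 2 → k} (hl : l ≠ 0) {u : S.presheaf.stalk x}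
    (hu : u ∈ IsLocalRing.maximalIdeal (S.presheaf.stalk x)) :
    ∃ σ : Γ(E, ⊤), (∀ i, v ((he x).stalkCoord (hxU x) σ i) = 0) ∧
      ∑ i, stalkConst f x (l i) * (he x).stalkCoord (hxU x) σ i - u ∈
        IsLocalRing.maximalIdeal (S.presheaf.stalk x) ^ 2 := by
  let O := S.presheaf.stalk x
  let κ : k →+* O := (stalkConst f x).hom
  let w : O →+* k := v.hom
  let c := (he x).stalkCoord (hxU x)
  have hvc (a : k) : w (κ a) = a := CategoryTheory.congr_fun hv a
  have hmem {a : O} : a ∈ IsLocalRing.maximalIdeal O ↔ w a = 0 :=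
    IsLocalRing.mem_maximalIdeal_iff_of_section hvc
  have hcs (a : k) (σ : Γ(E, ⊤)) (i) : c (globalConst f a • σ) i = κ a * c σ i :=
    (he x).stalkCoord_const_smul (hxU x) a σ i
  let J : Ideal O :=
    { carrier := {u | w u = 0 ∧ ∃ σ : Γ(E, ⊤), (∀ i, w (c σ i) = 0) ∧
        ∑ i, κ (l i) * c σ i - u ∈ IsLocalRing.maximalIdeal O ^ 2}
      add_mem' := by
        rintro a b ⟨ha, σ, hσ, hσa⟩ ⟨hb, τ, hτ, hτb⟩
        refine ⟨by simp [ha, hb], σ + τ, fun i ↦ by simp [hσ, hτ], ?_⟩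
        convert add_mem hσa hτb using 1
        simp only [map_add, Pi.add_apply, mul_add, Finset.sum_add_distrib]
        ring
      zero_mem' := ⟨map_zero _, 0, by simp, by simp⟩
      smul_mem' := by
        rintro a b ⟨hb, σ, hσ, hσb⟩
        refine ⟨by simp [hb], globalConst f (w a) • σ, fun i ↦ by simp [hcs, hσ], ?_⟩
        have h1 : (κ (w a) - a) * b ∈ IsLocalRing.maximalIdeal O ^ 2 := by
          rw [pow_two]
          exact Ideal.mul_mem_mul (hmem.2 (by simp [hvc])) (hmem.2 hb)
        convert add_mem (Ideal.mul_mem_left _ (κ (w a)) hσb) h1 using 1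
        simp only [hcs, smul_eq_mul, mul_sub, Finset.mul_sum, mul_left_comm (κ (w a))]
        ring }
  suffices h : u ∈ J from h.2
  have hJ : J ≠ ⊤ := fun h ↦ by
    have : (1 : O) ∈ J := h ▸ trivial
    exact one_ne_zero ((map_one w).symm.trans this.1)
  have : Nontrivial (O ⧸ J) := Ideal.Quotient.nontrivial_iff.2 hJ
  have : IsLocalRing (CommRingCat.of (O ⧸ J)) :=
    IsLocalRing.of_surjective' (Ideal.Quotient.mk J) Ideal.Quotient.mk_surjective
  obtain ⟨j, hj⟩ : ∃ j, l j ≠ 0 := Function.ne_iff.1 hl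
  choose τ hτ using fun j ↦ hva.exists_eval_eq hU hxU he hv (Pi.single j 1)
  have hwc (j) : w (∑ i, κ (l i) * c (τ j) i) = l j := by
    simp only [map_sum, map_mul, hvc]
    rw [Finset.sum_congr rfl fun i _ ↦ congrArg (l i * ·) (hτ j i)]
    simp [Pi.single_apply]
  let ρ : S.presheaf.stalk x ⟶ .of (O ⧸ J) := CommRingCat.ofHom (Ideal.Quotient.mk J)
  let ρ' : S.presheaf.stalk x ⟶ .of (O ⧸ J) :=
    CommRingCat.ofHom ((Ideal.Quotient.mk J).comp (κ.comp w))
  have key : ρ = ρ' := by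
    have := (hva.separates hU hxU he).2 x x (.of (O ⧸ J)) ρ ρ'
      (fun i ↦ Ideal.Quotient.mk J (κ (l i)))
      (fun j ↦ Ideal.Quotient.mk J (∑ i, κ (l i) * c (τ j) i))
      ⟨j, ((IsUnit.mk0 _ hj).map κ).map (Ideal.Quotient.mk J)⟩
      ⟨j, IsUnit.map (Ideal.Quotient.mk J) ((isUnit_iff_of_section hv).2 ?_)⟩ ?_ fun σ ↦ ?_
    · exact Spec.map_injective ((cancel_mono _).1 this)
    · exact (hwc j).trans_ne hj
    · ext a
      change Ideal.Quotient.mk J (κ a) = Ideal.Quotient.mk J (κ (w (κ a)))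
      rw [hvc]
    · change ∑ i, Ideal.Quotient.mk J (c σ i) * Ideal.Quotient.mk J (κ (l i)) =
        ∑ j, Ideal.Quotient.mk J (κ (w (c σ j))) * Ideal.Quotient.mk J (∑ i, κ (l i) * c (τ j) i)
      simp only [← map_mul, ← map_sum]
      rw [Ideal.Quotient.eq]
      have h1 (i) : c (σ - ∑ j, globalConst f (w (c σ j)) • τ j) i =
          c σ i - ∑ j, κ (w (c σ j)) * c (τ j) i := by
        simp only [map_sub, map_sum, Pi.sub_apply, Finset.sum_apply, hcs]
      have h2 : ∑ i, c σ i * κ (l i) - ∑ j, κ (w (c σ j)) * ∑ i, κ (l i) * c (τ j) i =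
          ∑ i, κ (l i) * c (σ - ∑ j, globalConst f (w (c σ j)) • τ j) i := by
        rw [Finset.sum_congr rfl fun i _ ↦ congrArg (κ (l i) * ·) (h1 i)]
        simp only [Fin.sum_univ_two]
        ring
      rw [h2]
      have h3 (i) : w (c (σ - ∑ j, globalConst f (w (c σ j)) • τ j) i) = 0 := by
        rw [h1, map_sub, map_sum, sub_eq_zero]
        simp only [map_mul, hvc]
        rw [Finset.sum_congr rfl fun j _ ↦ congrArg (w (c σ j) * ·) (hτ j i)]
        simp [Pi.single_apply]
      refine ⟨?_, _, h3, by simp⟩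
      simp only [map_sum, map_mul, h3, mul_zero, Finset.sum_const_zero]
  rw [← Ideal.Quotient.eq_zero_iff_mem]
  refine (CategoryTheory.congr_fun key u).trans ?_
  change Ideal.Quotient.mk J (κ (w u)) = 0
  rw [hmem.1 hu, map_zero, map_zero]

end AlgebraicGeometry.Scheme.Modules.IsVeryAmple

/-- An alternating map in `n` variables on a free module of rank `n` is a multiple of the
determinant. -/
lemma AlternatingMap.eq_det_smul {R M N ι : Type*} [CommRing R] [AddCommGroup M] [Module R M]
    [AddCommGroup N] [Module R N] [Fintype ι] [DecidableEq ι] (b : Module.Basis ι R M)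
    (ω : M [⋀^ι]→ₗ[R] N) (m : ι → M) : ω m = b.det m • ω b := by
  suffices h : ω = (LinearMap.toSpanSingleton R N (ω b)).compAlternatingMap b.det from
    congrArg (· m) h
  refine b.ext_alternating fun v hv ↦ ?_
  let p := Equiv.ofBijective v (Finite.injective_iff_bijective.1 hv)
  change ω (b ∘ p) = b.det (b ∘ p) • ω b
  rw [ω.map_perm, b.det.map_perm, b.det_self, Units.smul_def, Units.smul_def]
  simp [Int.cast_smul_eq_zsmul]

namespace AlgebraicGeometry.Scheme.Modules

variable {X : Scheme.{u}} (M : X.Modules) (n : ℕ)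

/-- The canonical map from the exterior power of the sections to the sections of the exterior
power. -/
def toExteriorPower (V : X.Opens) :
    (⋀[Γ(X, V)]^n Γ(M, V)) →ₗ[Γ(X, V)] Γ(M.exteriorPower n, V) where
  toFun t := ((PresheafOfModules.sheafificationAdjunction (𝟙 X.ringCatSheaf.obj)).unit.app
    (M.exteriorPowerPresheaf n)).app (op V) t
  map_add' s t := (((PresheafOfModules.sheafificationAdjunction (𝟙 X.ringCatSheaf.obj)).unit.app
    (M.exteriorPowerPresheaf n)).app (op V)).hom.map_add s t
  map_smul' a t := (((PresheafOfModules.sheafificationAdjunction (𝟙 X.ringCatSheaf.obj)).unit.app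
    (M.exteriorPowerPresheaf n)).app (op V)).hom.map_smul a t

/-- The exterior product of sections. -/
def wedge (V : X.Opens) : Γ(M, V) [⋀^Fin n]→ₗ[Γ(X, V)] Γ(M.exteriorPower n, V) :=
  (M.toExteriorPower n V).compAlternatingMap (_root_.exteriorPower.ιMulti Γ(X, V) n)

lemma wedge_res {V W : X.Opens} (i : W ⟶ V) (m : Fin n → Γ(M, V)) :
    (M.exteriorPower n).presheaf.map i.op (M.wedge n V m) =
      M.wedge n W fun j ↦ M.presheaf.map i.op (m j) := by
  have h := CategoryTheory.congr_fun ((CategoryTheory.toSheafify (Opens.grothendieckTopology X)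
    (M.exteriorPowerAb n)).naturality i.op) (_root_.exteriorPower.ιMulti Γ(X, V) n m)
  refine h.symm.trans ?_
  change M.toExteriorPower n W (_root_.exteriorPower.mapSemilinear (X.presheaf.map i.op).hom
    (M.resₛₗ i) n (_root_.exteriorPower.ιMulti Γ(X, V) n m)) = _
  rw [_root_.exteriorPower.mapSemilinear_ιMulti]
  rfl

lemma exists_toExteriorPower_eq {V : X.Opens} (s : Γ(M.exteriorPower n, V)) {x : X} (hx : x ∈ V) :
    ∃ (W : X.Opens) (i : W ⟶ V) (_ : x ∈ W) (t : ⋀[Γ(X, W)]^n Γ(M, W)),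
      M.toExteriorPower n W t = (M.exteriorPower n).presheaf.map i.op s := by
  have : Presheaf.IsLocallySurjective (Opens.grothendieckTopology X)
    (CategoryTheory.toSheafify (Opens.grothendieckTopology X) (M.exteriorPowerAb n)) := inferInstance
  obtain ⟨W, i, ⟨t, ht⟩, hxW⟩ := this.imageSieve_mem (U := V) s x hx
  exact ⟨W, i, hxW, t, ht⟩

lemma germ_smul {V : X.Opens} {x : X} (hx : x ∈ V) (a : Γ(X, V)) (s : Γ(M, V)) :
    M.presheaf.germ V x hx (a • s) = X.presheaf.germ V x hx a • M.presheaf.germ V x hx s :=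
  _root_.PresheafOfModules.germ_smul (R := X.presheaf) (M := M.val) x V hx a s

variable {M n} {U : X.Opens} {e : Fin n → Γ(M, U)} (he : M.IsFrame U e)

include he

lemma IsFrame.exists_germ_eq {x : X} (hx : x ∈ U) (z : (M.exteriorPower n).presheaf.stalk x) :
    ∃ a : X.presheaf.stalk x, z = a • (M.exteriorPower n).presheaf.germ U x hx (M.wedge n U e) := by
  obtain ⟨V, hxV, s, rfl⟩ := TopCat.Presheaf.exists_germ_eq _ z
  obtain ⟨W, i, hxW, t, ht⟩ := M.exists_toExteriorPower_eq n
    ((M.exteriorPower n).presheaf.map (homOfLE inf_le_left : V ⊓ U ⟶ V).op s)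
    (show x ∈ V ⊓ U from ⟨hxV, hx⟩)
  have hWU : W ≤ U := i.le.trans inf_le_right
  obtain ⟨b, hb⟩ := he W hWU
  obtain ⟨a, ha⟩ : ∃ a : Γ(X, W), M.toExteriorPower n W t = a • M.wedge n W b := by
    clear ht
    induction t using _root_.exteriorPower.induction_ιMulti with
    | h m => exact ⟨b.det m, AlternatingMap.eq_det_smul b (M.wedge n W) m⟩
    | h0 => exact ⟨0, by rw [map_zero, zero_smul]⟩
    | hadd x y hx hy =>
      obtain ⟨a, ha⟩ := hx
      obtain ⟨a', ha'⟩ := hy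
      exact ⟨a + a', by rw [map_add, ha, ha', add_smul]⟩
    | hsmul r x hx =>
      obtain ⟨a, ha⟩ := hx
      exact ⟨r * a, by rw [_root_.map_smul, ha, mul_smul]⟩
  refine ⟨X.presheaf.germ W x hxW a, ?_⟩
  have h1 : M.wedge n W b = (M.exteriorPower n).presheaf.map (homOfLE hWU).op (M.wedge n U e) := by
    rw [wedge_res]
    exact congrArg _ (funext hb)
  rw [← TopCat.Presheaf.germ_res_apply _ (homOfLE hWU) x hxW, ← h1, ← germ_smul, ← ha, ht,
    TopCat.Presheaf.germ_res_apply, TopCat.Presheaf.germ_res_apply]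

lemma IsFrame.germ_wedge {x : X} (hx : x ∈ U) (σ : Fin n → Γ(M, ⊤)) :
    (M.exteriorPower n).presheaf.germ ⊤ x (Opens.mem_top x) (M.wedge n ⊤ σ) =
      (Matrix.of fun i j ↦ he.stalkCoord hx (σ j) i).det •
        (M.exteriorPower n).presheaf.germ U x hx (M.wedge n U e) := by
  have hb : M.wedge n U (he U le_rfl).choose = M.wedge n U e :=
    congrArg _ (funext fun j ↦ ((he U le_rfl).choose_spec j).trans
      (CategoryTheory.congr_fun (M.presheaf.map_id _) (e j)))
  rw [← TopCat.Presheaf.germ_res_apply _ (homOfLE le_top) x hx, wedge_res,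
    AlternatingMap.eq_det_smul (he U le_rfl).choose, germ_smul, hb, Module.Basis.det_apply]
  congr 1
  exact RingHom.map_det (X.presheaf.germ U x hx).hom _

end AlgebraicGeometry.Scheme.Modules

section BinaryForms

variable {k : Type*} [Field k]

/-- The coefficients of the product of two binary linear forms. -/
def linearFormMul (p q : Fin 2 → k) : Fin 3 → k :=
  ![p 0 * q 0, p 0 * q 1 + p 1 * q 0, p 1 * q 1]

lemma IsAlgClosed.exists_binary_quadratic_zero [IsAlgClosed k] (a b c : k) :
    ∃ s t : k, (s ≠ 0 ∨ t ≠ 0) ∧ a * s ^ 2 + b * (s * t) + c * t ^ 2 = 0 := by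
  by_cases ha : a = 0
  · exact ⟨1, 0, by simp, by simp [ha]⟩
  · obtain ⟨s, hs⟩ := IsAlgClosed.exists_root
      (Polynomial.C a * .X ^ 2 + Polynomial.C b * .X + Polynomial.C c)
      (by rw [Polynomial.degree_quadratic ha]; decide)
    refine ⟨s, 1, by simp, ?_⟩
    simpa [Polynomial.IsRoot] using hs

/-- If the pairs of linear forms in `Z` map onto the linear forms under every nonzero linear
combination, then the determinants of elements of `Z` span the quadratic forms. -/
lemma span_det_eq_top [IsAlgClosed k] (Z : Submodule k ((Fin 2 → k) × (Fin 2 → k)))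
    (hZ : ∀ l : Fin 2 → k, l ≠ 0 → ∀ p, ∃ z ∈ Z, l 0 • z.1 + l 1 • z.2 = p)
    (Q : Submodule k (Fin 3 → k))
    (hQ : ∀ z ∈ Z, ∀ z' ∈ Z, linearFormMul z.1 z'.2 - linearFormMul z'.1 z.2 ∈ Q) : Q = ⊤ := by
  by_contra hne
  obtain ⟨F, hF, hQF⟩ := Submodule.exists_le_ker_of_lt_top Q (lt_top_iff_ne_top.2 hne)
  obtain ⟨A, B, C, hF'⟩ : ∃ A B C : k, ∀ q, F q = A * q 0 + B * q 1 + C * q 2 := by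
    refine ⟨F (Pi.single 0 1), F (Pi.single 1 1), F (Pi.single 2 1), fun q ↦ ?_⟩
    rw [← LinearMap.sum_mul_apply_single F q, Fin.sum_univ_three]
    ring
  have hABC : A ≠ 0 ∨ B ≠ 0 ∨ C ≠ 0 := by
    by_contra! h
    exact hF (LinearMap.ext fun q ↦ by simp [hF', h])
  have hfst (p : Fin 2 → k) : ∃ b, (p, b) ∈ Z := by
    obtain ⟨z, hz, h⟩ := hZ ![1, 0] (by simp) p
    refine ⟨z.2, ?_⟩
    simp only [Matrix.cons_val_zero, Matrix.cons_val_one, one_smul, zero_smul, add_zero] at h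
    rwa [← h]
  suffices h : ∃ a b : Fin 2 → k, ∃ c : k, (a, b) ∈ Z ∧
      (A * a 0 + B * a 1 ≠ 0 ∨ B * a 0 + C * a 1 ≠ 0) ∧
      A * b 0 + B * b 1 = c * (A * a 0 + B * a 1) ∧
      B * b 0 + C * b 1 = c * (B * a 0 + C * a 1) by
    obtain ⟨a, b, c, hab, hne, h1, h2⟩ := h
    have key (p : Fin 2 → k) : (A * a 0 + B * a 1) * p 0 + (B * a 0 + C * a 1) * p 1 = 0 := by
      obtain ⟨⟨a', b'⟩, hz, h⟩ := hZ ![-c, 1] (by simp) p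
      have h3 := hQF (hQ _ hab _ hz)
      rw [LinearMap.mem_ker, map_sub, hF', hF'] at h3
      simp only [linearFormMul, Matrix.cons_val] at h3
      rw [← h]
      simp only [Matrix.cons_val_zero, Matrix.cons_val_one, Pi.add_apply, Pi.smul_apply,
        smul_eq_mul]
      linear_combination h3 + h1 * a' 0 + h2 * a' 1
    rcases hne with h | h
    · exact h (by simpa using key ![1, 0])
    · exact h (by simpa using key ![0, 1])
  by_cases hdet : A * C - B * B = 0
  · by_cases hA : A = 0
    · have hB : B = 0 := by simpa [hA] using hdet
      have hC : C ≠ 0 := by simpa [hA, hB] using hABC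
      obtain ⟨b, hb⟩ := hfst ![0, 1]
      exact ⟨_, b, b 1, hb, by simp [hA, hB, hC], by simp [hA, hB], by simp [hB, mul_comm]⟩
    · obtain ⟨b, hb⟩ := hfst ![1, 0]
      refine ⟨_, b, (A * b 0 + B * b 1) / A, hb, by simp [hA], by simp [hA], ?_⟩
      simp only [Matrix.cons_val_zero, Matrix.cons_val_one]
      field_simp
      linear_combination b 1 * hdet
  · obtain ⟨b, hb⟩ := hfst ![1, 0]
    obtain ⟨b', hb'⟩ := hfst ![0, 1]
    obtain ⟨s, t, hst, h⟩ := IsAlgClosed.exists_binary_quadratic_zero (b 1) (b' 1 - b 0) (-b' 0)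
    have hz : (![s, t], s • b + t • b') ∈ Z := by
      convert add_mem (Z.smul_mem s hb) (Z.smul_mem t hb') using 1
      ext i
      · fin_cases i <;> simp
      · simp
    obtain ⟨c, hc0, hc1⟩ : ∃ c, s * b 0 + t * b' 0 = c * s ∧ s * b 1 + t * b' 1 = c * t := by
      by_cases hs : s = 0
      · have ht : t ≠ 0 := by simpa [hs] using hst
        have h0 : b' 0 = 0 := by simpa [hs, ht] using h
        exact ⟨b' 1, by simp [hs, h0], by simp [hs, mul_comm]⟩
      · refine ⟨(s * b 0 + t * b' 0) / s, by field_simp, ?_⟩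
        field_simp
        linear_combination h
    refine ⟨_, _, c, hz, ?_, ?_, ?_⟩
    · by_contra! h'
      simp only [Matrix.cons_val_zero, Matrix.cons_val_one] at h'
      have hs : (A * C - B * B) * s = 0 := by linear_combination C * h'.1 - B * h'.2
      have ht : (A * C - B * B) * t = 0 := by linear_combination A * h'.2 - B * h'.1
      simp only [mul_eq_zero, hdet, false_or] at hs ht
      simp [hs, ht] at hst
    · simp only [Matrix.cons_val_zero, Matrix.cons_val_one, Pi.add_apply, Pi.smul_apply,
        smul_eq_mul]
      linear_combination A * hc0 + B * hc1
    · simp only [Matrix.cons_val_zero, Matrix.cons_val_one, Pi.add_apply, Pi.smul_apply,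
        smul_eq_mul]
      linear_combination B * hc0 + C * hc1

end BinaryForms

open IsLocalRing in
/-- Determinants of pairs of sections vanishing at a point span the second order jets. -/
lemma sq_maximalIdeal_le_of_det_mem {k O W : Type*} [Field k] [IsAlgClosed k] [CommRing O]
    [IsLocalRing O] [AddCommGroup W] {κ : k →+* O} {v : O →+* k} (hv : ∀ a, v (κ a) = a)
    {t : Fin 2 → O} (ht : ∀ i, t i ∈ maximalIdeal O)
    (ht' : maximalIdeal O ≤ Ideal.span (Set.range t) ⊔ maximalIdeal O ^ 2)
    {c : W →+ (Fin 2 → O)} (hc : ∀ a σ, ∃ τ, ∀ i, c τ i = κ a * c σ i)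
    (hcs : ∀ l : Fin 2 → k, l ≠ 0 → ∀ x ∈ maximalIdeal O, ∃ σ, (∀ i, v (c σ i) = 0) ∧
      ∑ i, κ (l i) * c σ i - x ∈ maximalIdeal O ^ 2)
    {G : AddSubgroup O} (hGs : ∀ a, ∀ x ∈ G, κ a * x ∈ G)
    (hG : ∀ x ∈ maximalIdeal O ^ 3, x ∈ G)
    (hGc : ∀ σ τ, (∀ i, v (c σ i) = 0) → (∀ i, v (c τ i) = 0) →
      c σ 0 * c τ 1 - c τ 0 * c σ 1 ∈ G) {x : O} (hx : x ∈ maximalIdeal O ^ 2) : x ∈ G := by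
  have hmem {a : O} : a ∈ maximalIdeal O ↔ v a = 0 := mem_maximalIdeal_iff_of_section hv
  let lin (p : Fin 2 → k) : O := κ (p 0) * t 0 + κ (p 1) * t 1
  let quad (q : Fin 3 → k) : O := κ (q 0) * t 0 ^ 2 + κ (q 1) * (t 0 * t 1) + κ (q 2) * t 1 ^ 2
  have hlin (p) : lin p ∈ maximalIdeal O :=
    add_mem (Ideal.mul_mem_left _ _ (ht 0)) (Ideal.mul_mem_left _ _ (ht 1))
  have hmul (p q) : lin p * lin q = quad (linearFormMul p q) := by
    simp only [lin, quad, linearFormMul, Matrix.cons_val, map_add, map_mul]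
    ring
  have hadd (q q') : quad (q + q') = quad q + quad q' := by
    simp only [quad, Pi.add_apply, map_add]
    ring
  have hsub (q q') : quad (q - q') = quad q - quad q' := by
    simp only [quad, Pi.sub_apply, map_sub]
    ring
  have hmul' {a b a' b' : O} (ha : a - a' ∈ maximalIdeal O ^ 2) (hb : b - b' ∈ maximalIdeal O ^ 2)
      (ha' : a' ∈ maximalIdeal O) (hb' : b ∈ maximalIdeal O) :
      a * b - a' * b' ∈ maximalIdeal O ^ 3 := by
    have h1 := Ideal.mul_mem_mul ha hb'
    have h2 := Ideal.mul_mem_mul ha' hb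
    rw [← pow_succ] at h1
    rw [← pow_succ'] at h2
    convert add_mem h1 h2 using 1
    ring
  have hexlin {a : O} (ha : a ∈ maximalIdeal O) : ∃ p, a - lin p ∈ maximalIdeal O ^ 2 := by
    obtain ⟨y, hy, z, hz, rfl⟩ := Submodule.mem_sup.1 (ht' ha)
    obtain ⟨b, rfl⟩ := (Submodule.mem_span_range_iff_exists_fun O).1 hy
    refine ⟨fun i ↦ v (b i), ?_⟩
    have h (i) : (b i - κ (v (b i))) * t i ∈ maximalIdeal O ^ 2 := by
      rw [pow_two]
      exact Ideal.mul_mem_mul (hmem.2 (by simp [hv])) (ht i)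
    convert add_mem hz (add_mem (h 0) (h 1)) using 1
    simp only [lin, Fin.sum_univ_two, smul_eq_mul]
    ring
  have hexquad {a : O} (ha : a ∈ maximalIdeal O ^ 2) : ∃ q, a - quad q ∈ maximalIdeal O ^ 3 := by
    rw [pow_two] at ha
    induction ha using Submodule.mul_induction_on' with
    | mem_mul_mem a ha b hb =>
      obtain ⟨p, hp⟩ := hexlin ha
      obtain ⟨q, hq⟩ := hexlin hb
      exact ⟨_, hmul p q ▸ hmul' hp hq (hlin p) hb⟩
    | add a _ b _ ha hb =>
      obtain ⟨p, hp⟩ := ha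
      obtain ⟨q, hq⟩ := hb
      refine ⟨p + q, ?_⟩
      rw [hadd]
      convert add_mem hp hq using 1
      ring
  let Z : Submodule k ((Fin 2 → k) × (Fin 2 → k)) :=
    { carrier := {z | ∃ σ, c σ 0 - lin z.1 ∈ maximalIdeal O ^ 2 ∧
        c σ 1 - lin z.2 ∈ maximalIdeal O ^ 2}
      add_mem' := by
        rintro z z' ⟨σ, h0, h1⟩ ⟨τ, h0', h1'⟩
        refine ⟨σ + τ, ?_, ?_⟩
        · convert add_mem h0 h0' using 1
          simp only [lin, map_add, Pi.add_apply, Prod.fst_add]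
          ring
        · convert add_mem h1 h1' using 1
          simp only [lin, map_add, Pi.add_apply, Prod.snd_add]
          ring
      zero_mem' := ⟨0, by simp [lin], by simp [lin]⟩
      smul_mem' := by
        rintro a z ⟨σ, h0, h1⟩
        obtain ⟨τ, hτ⟩ := hc a σ
        refine ⟨τ, ?_, ?_⟩
        · convert Ideal.mul_mem_left _ (κ a) h0 using 1
          simp only [hτ, lin, Prod.smul_fst, Pi.smul_apply, smul_eq_mul, map_mul]
          ring
        · convert Ideal.mul_mem_left _ (κ a) h1 using 1
          simp only [hτ, lin, Prod.smul_snd, Pi.smul_apply, smul_eq_mul, map_mul]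
          ring }
  have hle : maximalIdeal O ^ 2 ≤ maximalIdeal O := Ideal.pow_le_self two_ne_zero
  have hvan {a : O} {p} (h : a - lin p ∈ maximalIdeal O ^ 2) : v a = 0 :=
    hmem.1 (by simpa using add_mem (hle h) (hlin p))
  let Q : Submodule k (Fin 3 → k) :=
    { carrier := {q | quad q ∈ G}
      add_mem' := fun {p q} hp hq ↦ by
        rw [Set.mem_ofPred_eq, hadd]
        exact add_mem hp hq
      zero_mem' := by simp [quad]
      smul_mem' := fun a q hq ↦ by
        have : quad (a • q) = κ a * quad q := by
          simp only [quad, Pi.smul_apply, smul_eq_mul, map_mul]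
          ring
        rw [Set.mem_ofPred_eq, this]
        exact hGs a _ hq }
  have hQ : Q = ⊤ := by
    refine span_det_eq_top Z (fun l hl p ↦ ?_) Q ?_
    · obtain ⟨σ, hσ, h⟩ := hcs l hl _ (hlin p)
      obtain ⟨a, ha⟩ := hexlin (hmem.2 (hσ 0))
      obtain ⟨b, hb⟩ := hexlin (hmem.2 (hσ 1))
      have hd : lin (p - (l 0 • a + l 1 • b)) ∈ maximalIdeal O ^ 2 := by
        convert sub_mem (add_mem (Ideal.mul_mem_left _ (κ (l 0)) ha)
          (Ideal.mul_mem_left _ (κ (l 1)) hb)) h using 1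
        simp only [lin, Fin.sum_univ_two, Pi.sub_apply, Pi.add_apply, Pi.smul_apply, smul_eq_mul,
          map_add, map_sub, map_mul]
        ring
      by_cases h0 : l 0 = 0
      · have h1 : l 1 ≠ 0 := fun h1 ↦ hl (by ext i; fin_cases i <;> simpa)
        refine ⟨(a, b + (l 1)⁻¹ • (p - (l 0 • a + l 1 • b))), ⟨σ, ha, ?_⟩, ?_⟩
        · convert sub_mem hb (Ideal.mul_mem_left _ (κ (l 1)⁻¹) hd) using 1
          simp only [lin, Pi.add_apply, Pi.smul_apply, smul_eq_mul, map_add, map_mul]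
          ring
        · ext i
          simp only [Pi.add_apply, Pi.sub_apply, Pi.smul_apply, smul_eq_mul]
          field_simp
          ring
      · refine ⟨(a + (l 0)⁻¹ • (p - (l 0 • a + l 1 • b)), b), ⟨σ, ?_, hb⟩, ?_⟩
        · convert sub_mem ha (Ideal.mul_mem_left _ (κ (l 0)⁻¹) hd) using 1
          simp only [lin, Pi.add_apply, Pi.smul_apply, smul_eq_mul, map_add, map_mul]
          ring
        · ext i
          simp only [Pi.add_apply, Pi.sub_apply, Pi.smul_apply, smul_eq_mul]
          field_simp
          ring
    · rintro ⟨a, b⟩ ⟨σ, ha, hb⟩ ⟨a', b'⟩ ⟨τ, ha', hb'⟩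
      change quad _ ∈ G
      have h1 := hmul' ha hb' (hlin _) (hmem.2 (hvan hb'))
      have h2 := hmul' ha' hb (hlin _) (hmem.2 (hvan hb))
      have h3 := hGc σ τ (Fin.forall_fin_two.2 ⟨hvan ha, hvan hb⟩)
        (Fin.forall_fin_two.2 ⟨hvan ha', hvan hb'⟩)
      convert sub_mem h3 (hG _ (sub_mem h1 h2)) using 1
      rw [hsub, ← hmul, ← hmul]
      ring
  obtain ⟨q, hq⟩ := hexquad hx
  have : quad q ∈ G := (hQ ▸ trivial : q ∈ Q)
  simpa using add_mem (hG _ hq) this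

lemma Finset.exists_le_ite_of_sum_eq_three {r : ℕ} {m : Fin r → ℕ} (hm : ∀ i, 0 < m i)
    (hsum : ∑ i, m i = 3) (i : Fin r) :
    ∃ y z : Fin r, ∀ j, j ≠ i → m j ≤ (if j = y then 1 else 0) + (if j = z then 1 else 0) := by
  have hle (T : Finset (Fin r)) : ∑ j ∈ T, m j ≤ 3 :=
    hsum ▸ Finset.sum_le_univ_sum_of_nonneg fun _ ↦ Nat.zero_le _
  by_cases h : ∃ y, y ≠ i
  · obtain ⟨y, hy⟩ := h
    by_cases h' : ∃ z, z ≠ i ∧ z ≠ y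
    · obtain ⟨z, hz, hzy⟩ := h'
      refine ⟨y, z, fun j hj ↦ ?_⟩
      have h1 := hle {i, y, z}
      rw [Finset.sum_insert (by simp [hy.symm, hz.symm]),
        Finset.sum_insert (by simp [hzy.symm]), Finset.sum_singleton] at h1
      have hi := hm i
      have hmy := hm y
      have hmz := hm z
      by_cases hjy : j = y
      · subst hjy; simp only [if_true]; omega
      by_cases hjz : j = z
      · subst hjz; simp only [if_true]; omega
      have h2 := hle {j, i, y, z}
      rw [Finset.sum_insert (by simp [hj, hjy, hjz]), Finset.sum_insert (by simp [hy.symm, hz.symm]),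
        Finset.sum_insert (by simp [hzy.symm]), Finset.sum_singleton] at h2
      have := hm j
      omega
    · push Not at h'
      refine ⟨y, y, fun j hj ↦ ?_⟩
      have h1 := hle {i, y}
      rw [Finset.sum_insert (by simp [hy.symm]), Finset.sum_singleton] at h1
      have := hm i
      rw [h' j hj, if_pos rfl]
      omega
  · push Not at h
    exact ⟨i, i, fun j hj ↦ absurd (h j) hj⟩

section JetAlgebra

open IsLocalRing

variable {k W : Type*} [Field k] [IsAlgClosed k] [AddCommGroup W] {r : ℕ} {O : Fin r → Type u}
  [∀ i, CommRing (O i)] [∀ i, IsLocalRing (O i)] {κ : ∀ i, k →+* O i} {v : ∀ i, O i →+* k}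

/-- Successive approximation of a family of jets. -/
lemma exists_sub_mem_pow_of_graded {m : Fin r → ℕ} (G : AddSubgroup (∀ i, O i))
    (hG : ∀ i, ∀ d < m i, ∀ x ∈ maximalIdeal (O i) ^ d, ∃ a ∈ G,
      a i - x ∈ maximalIdeal (O i) ^ (d + 1) ∧ ∀ j, j ≠ i → a j ∈ maximalIdeal (O j) ^ m j)
    (b : ∀ i, O i) : ∃ a ∈ G, ∀ i, a i - b i ∈ maximalIdeal (O i) ^ m i := by
  have h1 (i : Fin r) (d : ℕ) : d ≤ m i → ∃ a ∈ G, a i - b i ∈ maximalIdeal (O i) ^ d ∧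
      ∀ j, j ≠ i → a j ∈ maximalIdeal (O j) ^ m j := by
    induction d with
    | zero => exact fun _ ↦ ⟨0, zero_mem _, by simp, by simp⟩
    | succ d ih =>
      intro hd
      obtain ⟨a, ha, h, h'⟩ := ih (by omega)
      obtain ⟨a', ha', g, g'⟩ := hG i d hd _ h
      refine ⟨a - a', sub_mem ha ha', ?_, fun j hj ↦ sub_mem (h' j hj) (g' j hj)⟩
      convert neg_mem g using 1
      simp only [Pi.sub_apply]
      ring
  choose a haG ha ha' using fun i ↦ h1 i (m i) le_rfl
  refine ⟨∑ i, a i, sum_mem fun i _ ↦ haG i, fun i ↦ ?_⟩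
  rw [Finset.sum_apply, ← Finset.add_sum_erase _ _ (Finset.mem_univ i), add_sub_right_comm]
  exact add_mem (ha i) (sum_mem fun j hj ↦ ha' j i (Finset.ne_of_mem_erase hj).symm)

/-- Determinants of pairs of sections which separate points and tangent directions generate all
jets of total length three. -/
lemma exists_sub_mem_pow_of_separates (hv : ∀ i a, v i (κ i a) = a)
    {t : ∀ i, Fin 2 → O i} (ht : ∀ i l, t i l ∈ maximalIdeal (O i))
    (ht' : ∀ i, maximalIdeal (O i) ≤ Ideal.span (Set.range (t i)) ⊔ maximalIdeal (O i) ^ 2)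
    {c : ∀ i, W →+ (Fin 2 → O i)}
    (hc : ∀ (a : k) σ, ∃ τ, ∀ i l, c i τ l = κ i a * c i σ l)
    (h1 : ∀ i (a : Fin 2 → k), ∃ σ, ∀ l, v i (c i σ l) = a l)
    (h2 : ∀ i j, i ≠ j → ∀ a b : Fin 2 → k,
      ∃ σ, (∀ l, v i (c i σ l) = a l) ∧ ∀ l, v j (c j σ l) = b l)
    (h3 : ∀ i (l : Fin 2 → k), l ≠ 0 → ∀ x ∈ maximalIdeal (O i), ∃ σ, (∀ s, v i (c i σ s) = 0) ∧
      ∑ s, κ i (l s) * c i σ s - x ∈ maximalIdeal (O i) ^ 2)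
    {m : Fin r → ℕ} (hm : ∀ i, 0 < m i) (hsum : ∑ i, m i = 3)
    {G : AddSubgroup (∀ i, O i)} (hGs : ∀ a, ∀ x ∈ G, (fun i ↦ κ i a * x i) ∈ G)
    (hG : ∀ σ τ, (fun i ↦ c i σ 0 * c i τ 1 - c i τ 0 * c i σ 1) ∈ G) (b : ∀ i, O i) :
    ∃ a ∈ G, ∀ i, a i - b i ∈ maximalIdeal (O i) ^ m i := by
  have hmem {i} {a : O i} : a ∈ maximalIdeal (O i) ↔ v i a = 0 :=
    mem_maximalIdeal_iff_of_section (hv i)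
  have hle (T : Finset (Fin r)) : ∑ j ∈ T, m j ≤ 3 :=
    hsum ▸ Finset.sum_le_univ_sum_of_nonneg fun _ ↦ Nat.zero_le _
  have h12 (i y : Fin r) (a : Fin 2 → k) : ∃ σ, (∀ l, v i (c i σ l) = a l) ∧
      (y ≠ i → ∀ l, v y (c y σ l) = 0) := by
    by_cases hy : y = i
    · obtain ⟨σ, hσ⟩ := h1 i a
      exact ⟨σ, hσ, fun h ↦ absurd hy h⟩
    · obtain ⟨σ, hσ, hσ'⟩ := h2 i y (Ne.symm hy) a 0
      exact ⟨σ, hσ, fun _ ↦ hσ'⟩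
  refine exists_sub_mem_pow_of_graded G (fun i d hd x hx ↦ ?_) b
  have hd3 : m i ≤ 3 := by simpa using hle {i}
  obtain rfl | rfl | rfl : d = 0 ∨ d = 1 ∨ d = 2 := by omega
  · obtain ⟨y, z, hyz⟩ := Finset.exists_le_ite_of_sum_eq_three hm hsum i
    obtain ⟨σ, hσ, hσ'⟩ := h12 i y ![v i x, 0]
    obtain ⟨τ, hτ, hτ'⟩ := h12 i z ![0, 1]
    refine ⟨_, hG σ τ, ?_, fun j hj ↦ ?_⟩
    · rw [zero_add, pow_one, hmem]
      simp [hσ, hτ]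
    · refine Ideal.pow_le_pow_right (hyz j hj) ?_
      have hy (l) : c j σ l ∈ maximalIdeal (O j) ^ (if j = y then 1 else 0) := by
        split_ifs with h
        · subst h
          rw [pow_one, hmem, hσ' hj]
        · simp
      have hz (l) : c j τ l ∈ maximalIdeal (O j) ^ (if j = z then 1 else 0) := by
        split_ifs with h
        · subst h
          rw [pow_one, hmem, hτ' hj]
        · simp
      rw [pow_add, mul_comm (c j τ 0)]
      exact sub_mem (Ideal.mul_mem_mul (hy 0) (hz 1)) (Ideal.mul_mem_mul (hy 1) (hz 0))
  · obtain ⟨y, hy⟩ : ∃ y, ∀ j, j ≠ i → m j ≤ 1 ∧ j = y := by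
      by_cases h : ∃ y, y ≠ i
      · obtain ⟨y, hy⟩ := h
        refine ⟨y, fun j hj ↦ ⟨?_, ?_⟩⟩
        · have := hle {i, j}
          rw [Finset.sum_insert (by simp [hj.symm]), Finset.sum_singleton] at this
          omega
        · by_contra hjy
          have := hle {i, j, y}
          rw [Finset.sum_insert (by simp [hj.symm, hy.symm]), Finset.sum_insert (by simp [hjy]),
            Finset.sum_singleton] at this
          have := hm j
          have := hm y
          omega
      · push Not at h
        exact ⟨i, fun j hj ↦ absurd (h j) hj⟩
    obtain ⟨σ, hσ, hσ'⟩ := h12 i y ![1, 0]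
    rw [pow_one] at hx
    obtain ⟨τ, hτ, hτ'⟩ := h3 i ![0, 1] (by simp) x hx
    refine ⟨_, hG σ τ, ?_, fun j hj ↦ ?_⟩
    · have e1 : c i σ 0 - 1 ∈ maximalIdeal (O i) := by simp [hmem, hσ]
      have e2 : c i σ 1 ∈ maximalIdeal (O i) := by simp [hmem, hσ]
      have e3 := Ideal.mul_mem_mul e1 (hmem.2 (hτ 1))
      have e4 := Ideal.mul_mem_mul (hmem.2 (hτ 0)) e2
      rw [← pow_two] at e3 e4
      convert add_mem hτ' (sub_mem e3 e4) using 1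
      simp only [Fin.sum_univ_two, Matrix.cons_val_zero, Matrix.cons_val_one, map_zero, map_one]
      ring
    · obtain ⟨hj1, rfl⟩ := hy j hj
      refine Ideal.pow_le_pow_right hj1 ?_
      rw [pow_one, hmem]
      simp [hσ' hj]
  · have hi (j : Fin r) : j = i := by
      by_contra hj
      have := hle {i, j}
      rw [Finset.sum_insert (by simp [Ne.symm hj]), Finset.sum_singleton] at this
      have := hm j
      omega
    let G' : AddSubgroup (O i) :=
      { carrier := {x | ∃ a ∈ G, a i - x ∈ maximalIdeal (O i) ^ 3}
        add_mem' := by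
          rintro x y ⟨a, ha, h⟩ ⟨b, hb, h'⟩
          refine ⟨a + b, add_mem ha hb, ?_⟩
          convert add_mem h h' using 1
          simp only [Pi.add_apply]
          ring
        zero_mem' := ⟨0, zero_mem _, by simp⟩
        neg_mem' := by
          rintro x ⟨a, ha, h⟩
          refine ⟨-a, neg_mem ha, ?_⟩
          convert neg_mem h using 1
          simp only [Pi.neg_apply]
          ring }
    obtain ⟨a, ha, h⟩ : x ∈ G' := by
      refine sq_maximalIdeal_le_of_det_mem (hv i) (ht i) (ht' i) (c := c i)
        (fun a σ ↦ (hc a σ).imp fun τ h ↦ h i) (h3 i) (fun a x hx ↦ ?_) (fun x hx ↦ ?_)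
        (fun σ τ _ _ ↦ ?_) hx
      · obtain ⟨b, hb, h⟩ := hx
        refine ⟨_, hGs a b hb, ?_⟩
        rw [← mul_sub]
        exact Ideal.mul_mem_left _ _ h
      · exact ⟨0, zero_mem _, by simpa using hx⟩
      · exact ⟨_, hG σ τ, by simp⟩
    exact ⟨a, ha, h, fun j hj ↦ absurd (hi j) hj⟩

end JetAlgebra

open AlgebraicGeometry Scheme.Modules in
theorem mainTheorem3 {k : Type u} [Field k] [IsAlgClosed k] {S : Scheme.{u}}
    (f : S ⟶ Spec (.of k)) [SmoothOfRelativeDimension 2 f] (E : S.Modules)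
    (hE : E.IsLocallyFreeOfRank 2) (hva : E.IsVeryAmple f) :
    (E.exteriorPower 2).IsJetAmple 2 := by
  intro r x m hx hcl hm hsum z
  have : Smooth f := SmoothOfRelativeDimension.smooth 2 f
  obtain ⟨U, e, hU, hxU, he⟩ := exists_affine_frames hE
  choose v hv using fun i ↦ exists_eval f (hcl i)
  choose t ht ht' using fun i ↦ exists_generators (n := 2) f (hv i)
  let L := E.exteriorPower 2
  let w (i : Fin r) : L.presheaf.stalk (x i) :=
    L.presheaf.germ (U (x i)) (x i) (hxU _) (E.wedge 2 (U (x i)) (e (x i)))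
  choose z' hz' using fun i ↦ Submodule.Quotient.mk_surjective _ (z i)
  choose b hb using fun i ↦ (he (x i)).exists_germ_eq (hxU _) (z' i)
  let G : AddSubgroup (∀ i, S.presheaf.stalk (x i)) :=
    { carrier := {a | ∃ s : Γ(L, ⊤), ∀ i, L.presheaf.germ ⊤ (x i) (Opens.mem_top _) s = a i • w i}
      add_mem' := by
        rintro a b ⟨s, hs⟩ ⟨t, ht⟩
        exact ⟨s + t, fun i ↦ by rw [map_add, hs, ht, Pi.add_apply, add_smul]⟩
      zero_mem' := ⟨0, fun i ↦ by rw [map_zero, Pi.zero_apply, zero_smul]⟩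
      neg_mem' := by
        rintro a ⟨s, hs⟩
        exact ⟨-s, fun i ↦ by rw [map_neg, hs, Pi.neg_apply, neg_smul]⟩ }
  obtain ⟨a, ⟨s, hs⟩, ha⟩ := exists_sub_mem_pow_of_separates
    (κ := fun i ↦ (stalkConst f (x i)).hom) (v := fun i ↦ (v i).hom)
    (c := fun i ↦ (he (x i)).stalkCoord (hxU (x i)))
    (fun i a ↦ CategoryTheory.congr_fun (hv i) a) ht ht'
    (fun a σ ↦ ⟨globalConst f a • σ, fun i l ↦ IsFrame.stalkCoord_const_smul _ _ _ _ _⟩)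
    (fun i a ↦ hva.exists_eval_eq hU hxU he (hv i) a)
    (fun i j hij a b ↦ hva.exists_eval_eq_eval_eq hU hxU he (hx.ne hij) (hv i) (hv j) a b)
    (fun i l hl u hu ↦ hva.exists_sub_mem_sq hU hxU he (hv i) hl hu)
    hm hsum (G := G)
    (by
      rintro a y ⟨s, hs⟩
      refine ⟨globalConst f a • s, fun i ↦ ?_⟩
      rw [Scheme.Modules.germ_smul, hs, smul_smul]
      rfl)
    (fun σ τ ↦ ⟨E.wedge 2 ⊤ ![σ, τ], fun i ↦ by
      rw [(he (x i)).germ_wedge (hxU (x i)), Matrix.det_fin_two]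
      rfl⟩) b
  refine ⟨s, funext fun i ↦ ?_⟩
  rw [← hz']
  refine (Submodule.Quotient.eq _).2 ?_
  rw [hs, hb]
  change _ • w i - _ • w i ∈ _
  rw [← sub_smul]
  exact Submodule.smul_mem_smul (ha i) trivial

end
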